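/- Theorem 4. Let $d\in\mathbb N$, let $(A_n)_{n\in\mathbb N}$ be a sequence of bounded linear operators on $L^2(\mathbb R^d)$ and $A$ a bounded linear operator on $L^2(\mathbb R^d)$, with distribution kernels $a_n,a\in\mathcal S'(\mathbb R^{2d})$, that is $\langle A_nf,h\rangle=\langle a_n,h\otimes\overline f\rangle$ and $\langle Af,h\rangle=\langle a,h\otimes\overline f\rangle$ for all $f,h\in\mathcal S(\mathbb R^d)$, where $(h\otimes\overline f)(x,y)=h(x)\overline{f(y)}$ and $\langle\cdot,\cdot\rangle$ extends $\int u\overline v$. Assume that $A_n\to A$ in the strong operator topology, i.e. $A_nf\to Af$ in $L^2(\mathbb R^d)$ for every $f\in L^2(\mathbb R^d)$. For $0\neq g\in\mathcal S(\mathbb R^{m})$ and $u\in\mathcal S'(\mathbb R^{m})$ let $V_gu(x,\xi)=\langle u,e^{2\pi i\xi\cdot(\,\cdot\,)}g(\,\cdot-x)\rangle$ be the short-time Fourier transform, and for $p\in\{1,\infty\}$ let $M^p(\mathbb R^m)$ be the space of all $u\in\mathcal S'(\mathbb R^m)$ with $V_gu\in L^p(\mathbb R^{2m})$ (this does not depend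 on the window $g$). The weak-* topology of $M^\infty(\mathbb R^m)=(M^1(\mathbb R^m))'$ is that of the duality $\langle u,\varphi\rangle=\|g\|_{L^2}^{-2}\int_{\mathbb R^{2m}}V_gu(z)\,\overline{V_g\varphi(z)}\,dz$ for $u\in M^\infty$, $\varphi\in M^1$. Let $\mathcal FL^p(\mathbb R^m)$ be the space of all $u\in\mathcal S'(\mathbb R^m)$ whose Fourier transform $\mathcal Fu$ (normalised by $\mathcal Ff(\xi)=\int e^{-2\pi ix\cdot\xi}f(x)\,dx$) is in $L^p(\mathbb R^m)$. Let $(\mathcal FL^\infty)_{\rm loc}$ be the space of all $u\in\mathcal S'$ with $\phi u\in\mathcal FL^\infty$ for every $\phi\in C_c^\infty$, and $(\mathcal FL^1)_{\rm comp}$ the space of all $v\in\mathcal FL^1$ with compact support; they are paired by $\langle u,v\rangle=\int\mathcal F(\chi u)\,\overline{\mathcal Fv}\,d\xi$, where $\chi\in C_c^\infty$ is any function equal to $1$ in a neighbourhood of $\operatorname{supp}v$. Then, for every choice of the window $0\ne g\in\mathcal S(\mathbb R^{2d})$ in these definitions: 1. $a_n\in M^\infty(\mathbb R^{2d})$ for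 all $n\in\mathbb N$, and $a\in M^\infty(\mathbb R^{2d})$; 2. $a_n\to a$ in the weak-* topology of $M^\infty(\mathbb R^{2d})$. In particular, $a_n,a\in(\mathcal FL^\infty)_{\rm loc}(\mathbb R^{2d})$ and $a_n\to a$ in $(\mathcal FL^\infty)_{\rm loc}(\mathbb R^{2d})$ endowed with the topology $\sigma\big((\mathcal FL^\infty)_{\rm loc}(\mathbb R^{2d}),(\mathcal FL^1)_{\rm comp}(\mathbb R^{2d})\big)$. -/

import Mathlib

open MeasureTheory SchwartzMap FourierTransform Filter Topology
open scoped ComplexConjugate ENNReal ContDiff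

noncomputable section

namespace TimeFreq

section General

variable {V : Type*} [NormedAddCommGroup V] [InnerProductSpace ℝ V]

/-- Complex conjugation on the Schwartz space. -/
def conjSchwartz (φ : 𝓢(V, ℂ)) : 𝓢(V, ℂ) :=
  SchwartzMap.postcompCLM (𝕜 := ℝ) (Complex.conjCLE : ℂ →L[ℝ] ℂ) φ

@[simp]
theorem conjSchwartz_apply (φ : 𝓢(V, ℂ)) (x : V) : conjSchwartz φ x = conj (φ x) := rfl

/-- The bracket `⟨u, φ⟩` between `𝓢'` and `𝓢`, linear in `u` and antilinear in `φ`, which extends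
the inner product `∫ u conj φ`. Mathlib's `u φ` extends the bilinear `∫ u φ` instead. -/
def bracket (u : 𝓢'(V, ℂ)) (φ : 𝓢(V, ℂ)) : ℂ := u (conjSchwartz φ)

/-- The character `y ↦ exp (2 π i ξ · y)`. -/
def character (ξ y : V) : ℂ := Complex.exp (2 * Real.pi * Complex.I * (inner ℝ ξ y : ℝ))

theorem iteratedDeriv_cexp_real (c : ℂ) (n : ℕ) :
    iteratedDeriv n (fun t : ℝ ↦ Complex.exp (c * t)) =
      fun t : ℝ ↦ c ^ n * Complex.exp (c * t) := by
  induction n with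
  | zero => simp
  | succ n ih =>
    rw [iteratedDeriv_succ, ih]
    ext t
    have h : HasDerivAt (fun t : ℝ ↦ c * (t : ℂ)) (c * 1) t :=
      (Complex.ofRealCLM.hasDerivAt (x := t)).const_mul c
    rw [(h.cexp.const_mul (c ^ n)).deriv]
    ring

theorem hasTemperateGrowth_character (ξ : V) :
    Function.HasTemperateGrowth (character ξ) := by
  have h : Function.HasTemperateGrowth
      (fun t : ℝ ↦ Complex.exp (2 * Real.pi * Complex.I * (t : ℂ))) := by
    refine ⟨?_, fun n ↦ ⟨0, ‖(2 * Real.pi * Complex.I : ℂ) ^ n‖, fun t ↦ ?_⟩⟩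
    · exact Complex.contDiff_exp.comp (contDiff_const.mul Complex.ofRealCLM.contDiff)
    · rw [norm_iteratedFDeriv_eq_norm_iteratedDeriv, iteratedDeriv_cexp_real, norm_mul]
      have : 2 * (Real.pi : ℂ) * Complex.I * (t : ℂ) = ((2 * Real.pi * t : ℝ) : ℂ) * Complex.I := by
        push_cast; ring
      rw [this, Complex.norm_exp_ofReal_mul_I]
      simp
  exact h.comp (innerSL ℝ ξ).hasTemperateGrowth

/-- The time-frequency shift `π(x, ξ) = M_ξ T_x` on the Schwartz space. -/
def timeFreqShift (x ξ : V) (g : 𝓢(V, ℂ)) : 𝓢(V, ℂ) :=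
  SchwartzMap.smulLeftCLM ℂ (character ξ) (SchwartzMap.compSubConstCLM ℂ x g)

theorem timeFreqShift_apply (x ξ : V) (g : 𝓢(V, ℂ)) (y : V) :
    timeFreqShift x ξ g y =
      Complex.exp (2 * Real.pi * Complex.I * (inner ℝ ξ y : ℝ)) * g (y - x) := by
  rw [timeFreqShift, SchwartzMap.smulLeftCLM_apply_apply (hasTemperateGrowth_character ξ)]
  rfl

/-- The short-time Fourier transform `V_g f (x, ξ) = ⟨f, M_ξ T_x g⟩`. -/
def stft (g : 𝓢(V, ℂ)) (f : 𝓢'(V, ℂ)) (z : V × V) : ℂ :=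
  bracket f (timeFreqShift z.1 z.2 g)

/-- The topology `σ(X, Y)` on `X` of pointwise convergence against all `y : Y`, for a pairing `B`
of `X` and `Y`. -/
abbrev weakTopology {X Y : Type*} (B : X → Y → ℂ) : TopologicalSpace X :=
  TopologicalSpace.induced B inferInstance

/-- `X_loc`: the tempered distributions `u` with `φ u ∈ X` for every `φ ∈ C_c^∞`. -/
def localSpace (X : Set 𝓢'(V, ℂ)) : Set 𝓢'(V, ℂ) :=
  {u | ∀ φ : V → ℂ, ContDiff ℝ ∞ φ → HasCompactSupport φ →
    TemperedDistribution.smulLeftCLM ℂ φ u ∈ X}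

/-- `X_comp`: the elements of `X` with compact support. -/
def compSpace (X : Set 𝓢'(V, ℂ)) : Set 𝓢'(V, ℂ) :=
  {u | u ∈ X ∧ IsCompact (Distribution.dsupport u)}

section Measure

variable [FiniteDimensional ℝ V] [MeasurableSpace V] [BorelSpace V]

/-- The modulation space `M^p` (the unweighted case, with equal exponents) with respect to the
window `g`. -/
def modulationSpace (p : ℝ≥0∞) (g : 𝓢(V, ℂ)) : Set 𝓢'(V, ℂ) :=
  {f | MemLp (stft g f) p (volume : Measure (V × V))}

/-- The duality `⟨f, φ⟩ = ‖g‖₂⁻² ∫ V_g f(z) conj (V_g φ(z)) dz` of `M^∞` and `M^1`. -/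
def modulationPairing (g : 𝓢(V, ℂ)) (f : modulationSpace ∞ g) (φ : modulationSpace 1 g) : ℂ :=
  ((‖g.toLp 2 (volume : Measure V)‖ ^ 2 : ℝ) : ℂ)⁻¹ *
    ∫ z : V × V, stft g f.1 z * conj (stft g φ.1 z)

/-- The weak-* topology on `M^∞`, as the dual of `M^1`. -/
abbrev weakStarTopology (g : 𝓢(V, ℂ)) : TopologicalSpace (modulationSpace ∞ g) :=
  weakTopology (modulationPairing g)

/-- The Fourier-Lebesgue space `𝓕L^p`: the tempered distributions whose Fourier transform is given
by an `L^p` function. -/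
def fourierLebesgue (V : Type*) [NormedAddCommGroup V] [InnerProductSpace ℝ V]
    [FiniteDimensional ℝ V] [MeasurableSpace V] [BorelSpace V] (p : ℝ≥0∞) [Fact (1 ≤ p)] :
    Set 𝓢'(V, ℂ) :=
  {u | ∃ F : Lp ℂ p (volume : Measure V), 𝓕 u = Lp.toTemperedDistribution F}

/-- The Fourier transform of an element of `𝓕L^p`, as an element of `L^p`. -/
def fourierDensity {p : ℝ≥0∞} [Fact (1 ≤ p)] {u : 𝓢'(V, ℂ)} (hu : u ∈ fourierLebesgue V p) :
    Lp ℂ p (volume : Measure V) :=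
  hu.choose

/-- An element `v` of `(𝓕L^1)_comp` together with a cutoff function `χ ∈ C_c^∞` that is equal to
`1` on a neighbourhood of the support of `v`. -/
structure CutoffTest (V : Type*) [NormedAddCommGroup V] [InnerProductSpace ℝ V]
    [FiniteDimensional ℝ V] [MeasurableSpace V] [BorelSpace V] where
  v : 𝓢'(V, ℂ)
  mem : v ∈ compSpace (fourierLebesgue V 1)
  χ : V → ℂ
  smooth : ContDiff ℝ ∞ χ
  compact : HasCompactSupport χ
  eq_one : ∀ᶠ x in 𝓝ˢ (Distribution.dsupport v), χ x = 1

/-- The duality of `u ∈ (𝓕L^∞)_loc` and `v ∈ (𝓕L^1)_comp`, namely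
`⟨u, v⟩ = ⟨χ u, v⟩ = ∫ 𝓕(χ u) conj (𝓕 v)`, where `χ ∈ C_c^∞` is `1` near the support of `v`
(the value does not depend on the choice of `χ`). -/
def fourierLebesguePairing (u : localSpace (fourierLebesgue V ∞)) (t : CutoffTest V) : ℂ :=
  ∫ ξ : V, fourierDensity (u.2 t.χ t.smooth t.compact) ξ * conj (fourierDensity t.mem.1 ξ)

/-- The topology `σ((𝓕L^∞)_loc, (𝓕L^1)_comp)` on `(𝓕L^∞)_loc`. -/
abbrev sigmaTopology (V : Type*) [NormedAddCommGroup V] [InnerProductSpace ℝ V]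
    [FiniteDimensional ℝ V] [MeasurableSpace V] [BorelSpace V] :
    TopologicalSpace (localSpace (fourierLebesgue V ∞)) :=
  weakTopology fourierLebesguePairing

end Measure

end General

section Kernel

variable {V W : Type*} [NormedAddCommGroup V] [InnerProductSpace ℝ V]
  [NormedAddCommGroup W] [InnerProductSpace ℝ W]

theorem decay_one_add (f : 𝓢(V, ℂ)) (k n : ℕ) :
    ∃ C : ℝ, 0 ≤ C ∧ ∀ x, (1 + ‖x‖) ^ k * ‖iteratedFDeriv ℝ n f x‖ ≤ C :=
  ⟨2 ^ k * (((Finset.Iic (k, n)).sup fun m ↦ SchwartzMap.seminorm ℝ m.1 m.2) f),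
    by positivity, fun x ↦ SchwartzMap.one_add_le_sup_seminorm_apply (m := (k, n)) le_rfl le_rfl f x⟩

theorem norm_iteratedFDeriv_comp_le (f : 𝓢(V, ℂ)) (L : W →L[ℝ] V) (hL : ‖L‖ ≤ 1) (n : ℕ) (x : W) :
    ‖iteratedFDeriv ℝ n (fun y ↦ f (L y)) x‖ ≤ ‖iteratedFDeriv ℝ n f (L x)‖ := by
  have h := L.iteratedFDeriv_comp_right (f := f) (f.smooth n) x le_rfl
  change ‖iteratedFDeriv ℝ n (f ∘ L) x‖ ≤ _
  rw [h]
  refine (ContinuousMultilinearMap.norm_compContinuousLinearMap_le _ _).trans ?_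
  refine mul_le_of_le_one_right (norm_nonneg _) ?_
  exact Finset.prod_le_one (fun _ _ ↦ norm_nonneg _) (fun _ _ ↦ hL)

/-- The tensor product `(h ⊗ f)(x, y) = h(x) f(y)` of two Schwartz functions. -/
def tensor (h : 𝓢(V, ℂ)) (f : 𝓢(W, ℂ)) : 𝓢(WithLp 2 (V × W), ℂ) where
  toFun z := h z.fst * f z.snd
  smooth' := by
    have h1 : ContDiff ℝ ∞ (fun z : WithLp 2 (V × W) ↦ h z.fst) :=
      (h.smooth ⊤).comp (WithLp.fstL 2 ℝ V W).contDiff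
    have h2 : ContDiff ℝ ∞ (fun z : WithLp 2 (V × W) ↦ f z.snd) :=
      (f.smooth ⊤).comp (WithLp.sndL 2 ℝ V W).contDiff
    exact h1.mul h2
  decay' k n := by
    choose C hC0 hC using fun i ↦ decay_one_add h k i
    choose D hD0 hD using fun i ↦ decay_one_add f k i
    have n1 : ‖WithLp.fstL 2 ℝ V W‖ ≤ 1 := ContinuousLinearMap.opNorm_le_bound _ zero_le_one
      fun z ↦ by simpa using WithLp.norm_fst_le _ z
    have n2 : ‖WithLp.sndL 2 ℝ V W‖ ≤ 1 := ContinuousLinearMap.opNorm_le_bound _ zero_le_one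
      fun z ↦ by simpa using WithLp.norm_snd_le _ z
    have h1 : ContDiff ℝ ∞ (fun z : WithLp 2 (V × W) ↦ h z.fst) :=
      (h.smooth ⊤).comp (WithLp.fstL 2 ℝ V W).contDiff
    have h2 : ContDiff ℝ ∞ (fun z : WithLp 2 (V × W) ↦ f z.snd) :=
      (f.smooth ⊤).comp (WithLp.sndL 2 ℝ V W).contDiff
    refine ⟨∑ i ∈ Finset.range (n + 1), (n.choose i : ℝ) * C i * D (n - i), fun z ↦ ?_⟩
    have hz : ‖z‖ ≤ (1 + ‖z.fst‖) * (1 + ‖z.snd‖) := by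
      have hsq : ‖z‖ ^ 2 = ‖z.fst‖ ^ 2 + ‖z.snd‖ ^ 2 := WithLp.prod_norm_sq_eq_of_L2 z
      have a := norm_nonneg z.fst
      have b := norm_nonneg z.snd
      have : ‖z‖ ≤ ‖z.fst‖ + ‖z.snd‖ := by
        refine abs_le_of_sq_le_sq' ?_ (by positivity) |>.2
        nlinarith [mul_nonneg a b]
      nlinarith [mul_nonneg a b]
    calc ‖z‖ ^ k * ‖iteratedFDeriv ℝ n (fun z : WithLp 2 (V × W) ↦ h z.fst * f z.snd) z‖
        ≤ ((1 + ‖z.fst‖) * (1 + ‖z.snd‖)) ^ k *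
          ∑ i ∈ Finset.range (n + 1), (n.choose i : ℝ) *
            ‖iteratedFDeriv ℝ i (fun z : WithLp 2 (V × W) ↦ h z.fst) z‖ *
            ‖iteratedFDeriv ℝ (n - i) (fun z : WithLp 2 (V × W) ↦ f z.snd) z‖ := by
          gcongr
          exact norm_iteratedFDeriv_mul_le h1 h2 z (by exact_mod_cast le_top)
      _ ≤ ((1 + ‖z.fst‖) * (1 + ‖z.snd‖)) ^ k *
          ∑ i ∈ Finset.range (n + 1), (n.choose i : ℝ) *
            ‖iteratedFDeriv ℝ i h z.fst‖ * ‖iteratedFDeriv ℝ (n - i) f z.snd‖ := by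
          gcongr with i hi
          · exact norm_iteratedFDeriv_comp_le h (WithLp.fstL 2 ℝ V W) n1 i z
          · exact norm_iteratedFDeriv_comp_le f (WithLp.sndL 2 ℝ V W) n2 (n - i) z
      _ = ∑ i ∈ Finset.range (n + 1), (n.choose i : ℝ) *
            ((1 + ‖z.fst‖) ^ k * ‖iteratedFDeriv ℝ i h z.fst‖) *
            ((1 + ‖z.snd‖) ^ k * ‖iteratedFDeriv ℝ (n - i) f z.snd‖) := by
          rw [Finset.mul_sum, mul_pow]
          exact Finset.sum_congr rfl fun i _ ↦ by ring
      _ ≤ _ := by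
          gcongr with i hi
          · exact mul_nonneg (Nat.cast_nonneg _) (hC0 i)
          · exact hC i _
          · exact hD (n - i) _

@[simp]
theorem tensor_apply (h : 𝓢(V, ℂ)) (f : 𝓢(W, ℂ)) (z : WithLp 2 (V × W)) :
    tensor h f z = h z.fst * f z.snd := rfl

/-- The Euclidean space `ℝ^d`. -/
abbrev Eucl (d : ℕ) := EuclideanSpace ℝ (Fin d)

/-- The Euclidean space `ℝ^{2d} = ℝ^d × ℝ^d`. -/
abbrev Eucl2 (d : ℕ) := WithLp 2 (Eucl d × Eucl d)

/-- The Hilbert space `L^2(ℝ^d)`. -/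
abbrev L2 (d : ℕ) := Lp ℂ 2 (volume : Measure (Eucl d))

/-- `a ∈ 𝓢'(ℝ^{2d})` is the distribution kernel of `A`: `⟨A f, h⟩ = ⟨a, h ⊗ conj f⟩` for all
Schwartz functions `f`, `h` on `ℝ^d`. -/
def IsKernel {d : ℕ} (A : L2 d →L[ℂ] L2 d) (a : 𝓢'(Eucl2 d, ℂ)) : Prop :=
  ∀ f h : 𝓢(Eucl d, ℂ),
    bracket (Lp.toTemperedDistribution (A (f.toLp 2))) h = bracket a (tensor h (conjSchwartz f))

end Kernel

end TimeFreq

end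

/-! For a product window `γ = tensor w w`, every time-frequency shift of `γ` is again a tensor, so
`V_γ a` at a point is an `L²` matrix coefficient of `A` between shifted copies of `w` and `conj w`.
Shifts and conjugation preserve the `L²` norm. Hence `V_γ a` is bounded by `‖A‖ ‖w‖²`, and strong
convergence gives pointwise convergence.

An arbitrary window `g` is reached by superposition: `‖γ‖² g = ∫ V_γ g(z) π(z)γ dz`, where `V_γ g`
decays rapidly. Applying the distribution under the integral sign (`apply_eq_integral`) yields `‖γ‖²
V_g a(w) = ∫ conj (V_γ g(z)) ⟨a, π(w)π(z)γ⟩ dz` (`integral_schwartzStft_bracket`). The bracket in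
the integrand is again a matrix coefficient, so `V_g a` is bounded by a multiple of `‖A‖`
(`exists_norm_stft_kernel_le`). Banach–Steinhaus makes this uniform in `n`, and dominated
convergence gives `V_g a_n → V_g a` pointwise (`tendsto_stft_kernel`).

Both conclusions follow from bounded pointwise convergence by dominated convergence. For the weak-*
topology the integrable factor is `V_g φ` with `φ ∈ M^1`. For the Fourier-Lebesgue topology, `𝓕(χ
u)(ξ) = V_g u(0, ξ)` with `g = conj χ` (`fourier_smulLeftCLM_apply`), and the integrable factor is
`𝓕 v`. -/

noncomputable section

namespace TimeFreq

/-! ### Weak integrals of families of Schwartz functions -/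

section WeakIntegral

variable {V : Type*} [NormedAddCommGroup V] [NormedSpace ℝ V]

/-- The Banach space of bounded continuous functions with values in the continuous multilinear
maps. -/
def BoundedMultilinear (V : Type*) [NormedAddCommGroup V] [NormedSpace ℝ V] (n : ℕ) : Type _ :=
  BoundedContinuousFunction V (V [×n]→L[ℝ] ℂ)

instance (n : ℕ) : NormedAddCommGroup (BoundedMultilinear V n) :=
  BoundedContinuousFunction.instNormedAddCommGroup

instance (n : ℕ) : NormedSpace ℂ (BoundedMultilinear V n) :=
  BoundedContinuousFunction.instNormedSpace

instance (n : ℕ) : CompleteSpace (BoundedMultilinear V n) :=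
  BoundedContinuousFunction.instCompleteSpace

/-- Evaluation at a point. -/
def BoundedMultilinear.eval (n : ℕ) (y : V) : BoundedMultilinear V n →L[ℂ] (V [×n]→L[ℝ] ℂ) :=
  LinearMap.mkContinuous
    { toFun := fun f ↦ BoundedContinuousFunction.instFunLike.coe f y
      map_add' := fun _ _ ↦ rfl
      map_smul' := fun _ _ ↦ rfl } 1 fun f ↦ by
    rw [one_mul]
    exact BoundedContinuousFunction.norm_coe_le_norm (f : BoundedContinuousFunction V _) y

theorem BoundedMultilinear.eval_ext {n : ℕ} {f g : BoundedMultilinear V n}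
    (h : ∀ y, BoundedMultilinear.eval n y f = BoundedMultilinear.eval n y g) : f = g :=
  BoundedContinuousFunction.ext h

theorem BoundedMultilinear.norm_eval_le {n : ℕ} (f : BoundedMultilinear V n) (y : V) :
    ‖BoundedMultilinear.eval n y f‖ ≤ ‖f‖ :=
  BoundedContinuousFunction.norm_coe_le_norm (f : BoundedContinuousFunction V _) y

/-- The weighted derivative `y ↦ ‖y‖ ^ k • D^n φ y` of a Schwartz function, as a bounded continuous
function. -/
def weightedDerivFun (k n : ℕ) (φ : 𝓢(V, ℂ)) : BoundedMultilinear V n :=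
  BoundedContinuousFunction.ofNormedAddCommGroup
    (fun y ↦ (‖y‖ ^ k : ℝ) • iteratedFDeriv ℝ n φ y)
    ((continuous_norm.pow k).smul
      ((φ.smooth ⊤).continuous_iteratedFDeriv (by exact_mod_cast le_top)))
    (SchwartzMap.seminorm ℂ k n φ) (fun y ↦ by
      rw [norm_smul, norm_pow, norm_norm]
      exact φ.le_seminorm ℂ k n y)

theorem eval_weightedDerivFun (k n : ℕ) (φ : 𝓢(V, ℂ)) (y : V) :
    BoundedMultilinear.eval n y (weightedDerivFun k n φ) =
      (‖y‖ ^ k : ℝ) • iteratedFDeriv ℝ n φ y := rfl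

theorem norm_weightedDerivFun_le (k n : ℕ) (φ : 𝓢(V, ℂ)) :
    ‖weightedDerivFun k n φ‖ ≤ SchwartzMap.seminorm ℂ k n φ :=
  BoundedContinuousFunction.norm_ofNormedAddCommGroup_le _ (apply_nonneg _ _) _

/-- The map `φ ↦ ‖·‖ ^ k • D^n φ`, as a continuous linear map on the Schwartz space. -/
def weightedDeriv (k n : ℕ) : 𝓢(V, ℂ) →L[ℂ] BoundedMultilinear V n :=
  SchwartzMap.mkCLMtoNormedSpace (σ := RingHom.id ℂ) (weightedDerivFun k n)
    (fun f g ↦ BoundedMultilinear.eval_ext fun y ↦ by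
      simp only [map_add, eval_weightedDerivFun]
      change (‖y‖ ^ k : ℝ) • iteratedFDeriv ℝ n (f + g : V → ℂ) y = _
      rw [iteratedFDeriv_add_apply (f.smooth n).contDiffAt (g.smooth n).contDiffAt, smul_add])
    (fun c f ↦ BoundedMultilinear.eval_ext fun y ↦ by
      simp only [map_smul, eval_weightedDerivFun, RingHom.id_apply]
      change (‖y‖ ^ k : ℝ) • iteratedFDeriv ℝ n (c • f : V → ℂ) y = _
      rw [iteratedFDeriv_const_smul_apply (f.smooth n).contDiffAt, smul_comm])
    ⟨{(k, n)}, 1, zero_le_one, fun φ ↦ by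
      rw [one_mul, Finset.sup_singleton]
      exact norm_weightedDerivFun_le k n φ⟩

theorem eval_weightedDeriv (k n : ℕ) (φ : 𝓢(V, ℂ)) (y : V) :
    BoundedMultilinear.eval n y (weightedDeriv k n φ) =
      (‖y‖ ^ k : ℝ) • iteratedFDeriv ℝ n φ y := rfl

theorem norm_weightedDeriv_le (k n : ℕ) (φ : 𝓢(V, ℂ)) :
    ‖weightedDeriv k n φ‖ ≤ SchwartzMap.seminorm ℂ k n φ :=
  norm_weightedDerivFun_le k n φ

/-- With `norm_weightedDeriv_le` this identifies each Schwartz seminorm with a Banach space norm, so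
that Bochner integration becomes available. -/
theorem seminorm_le_norm_weightedDeriv (k n : ℕ) (φ : 𝓢(V, ℂ)) :
    SchwartzMap.seminorm ℂ k n φ ≤ ‖weightedDeriv k n φ‖ := by
  refine SchwartzMap.seminorm_le_bound ℂ k n φ (norm_nonneg _) fun y ↦ ?_
  have := BoundedMultilinear.norm_eval_le (weightedDeriv k n φ) y
  rwa [eval_weightedDeriv, norm_smul, norm_pow, norm_norm] at this

/-- No integrability is required, because an isomorphism preserves it in both directions. -/
theorem integral_comp_comm_linearIsometryEquiv {A B T : Type*} [NormedAddCommGroup A]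
    [NormedAddCommGroup B] [NormedSpace ℝ A] [NormedSpace ℝ B] [MeasurableSpace T] {μ : Measure T}
    (e : A ≃ₗᵢ[ℝ] B) (f : T → A) : ∫ t, e (f t) ∂μ = e (∫ t, f t ∂μ) :=
  e.toContinuousLinearEquiv.integral_comp_comm f

variable {T : Type*} [TopologicalSpace T] [SecondCountableTopology T] [MeasurableSpace T]
  [OpensMeasurableSpace T] {μ : Measure T} {F : T → 𝓢(V, ℂ)} {Φ : 𝓢(V, ℂ)}

/-- The target space need not be separable; strong measurability comes from continuity and the
second countability of `T`. -/
theorem integrable_weightedDeriv (hF : Continuous F)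
    (hb : ∀ k n, ∃ b : T → ℝ, Integrable b μ ∧ ∀ t, SchwartzMap.seminorm ℂ k n (F t) ≤ b t)
    (k n : ℕ) : Integrable (fun t ↦ weightedDeriv k n (F t)) μ := by
  obtain ⟨b, hb, hle⟩ := hb k n
  exact hb.mono' ((weightedDeriv k n).continuous.comp hF).aestronglyMeasurable
    (ae_of_all _ fun t ↦ (norm_weightedDeriv_le k n _).trans (hle t))

theorem integrable_iteratedFDeriv (hF : Continuous F)
    (hb : ∀ k n, ∃ b : T → ℝ, Integrable b μ ∧ ∀ t, SchwartzMap.seminorm ℂ k n (F t) ≤ b t)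
    (n : ℕ) (y : V) : Integrable (fun t ↦ iteratedFDeriv ℝ n (F t) y) μ := by
  have h := (BoundedMultilinear.eval n y).integrable_comp
    (integrable_weightedDeriv hF hb 0 n)
  simpa [eval_weightedDeriv] using h

/-- Differentiation under the integral sign for an integrable family of Schwartz functions. -/
theorem iteratedFDeriv_eq_integral (hF : Continuous F)
    (hb : ∀ k n, ∃ b : T → ℝ, Integrable b μ ∧ ∀ t, SchwartzMap.seminorm ℂ k n (F t) ≤ b t)
    (hΦ : ∀ y, Φ y = ∫ t, F t y ∂μ) (n : ℕ) (y : V) :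
    iteratedFDeriv ℝ n Φ y = ∫ t, iteratedFDeriv ℝ n (F t) y ∂μ := by
  induction n generalizing y with
  | zero =>
    simp only [iteratedFDeriv_zero_eq_comp, Function.comp_apply, hΦ]
    exact ((continuousMultilinearCurryFin0 ℝ V ℂ).symm.toContinuousLinearEquiv.integral_comp_comm
      _).symm
  | succ n ih =>
    let e := continuousMultilinearCurryLeftEquiv ℝ (fun _ : Fin (n + 1) ↦ V) ℂ
    -- The unweighted seminorm of order `n + 1` dominates the next derivative at all points `y` at
    -- once, so no localisation in `y` is needed.
    obtain ⟨b, hbi, hle⟩ := hb 0 (n + 1)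
    have key := hasFDerivAt_integral_of_dominated_of_fderiv_le (μ := μ) (𝕜 := ℝ)
      (F := fun y t ↦ iteratedFDeriv ℝ n (F t) y)
      (F' := fun y t ↦ fderiv ℝ (iteratedFDeriv ℝ n (F t)) y) (x₀ := y) (bound := b)
      (s := Set.univ) univ_mem
      (Eventually.of_forall fun y ↦ (integrable_iteratedFDeriv hF hb n y).aestronglyMeasurable)
      (integrable_iteratedFDeriv hF hb n y)
      (by
        simp only [fderiv_iteratedFDeriv]
        exact e.continuous.comp_aestronglyMeasurable
          (integrable_iteratedFDeriv hF hb (n + 1) y).aestronglyMeasurable)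
      (ae_of_all _ fun t y _ ↦ by
        rw [norm_fderiv_iteratedFDeriv]
        exact ((F t).norm_iteratedFDeriv_le_seminorm ℂ (n + 1) y).trans (hle t))
      hbi
      (ae_of_all _ fun t y _ ↦
        ((((F t).smooth ⊤).differentiable_iteratedFDeriv
          (by exact_mod_cast ENat.natCast_lt_top n)) y).hasFDerivAt)
    have hΦn : iteratedFDeriv ℝ n Φ = fun y ↦ ∫ t, iteratedFDeriv ℝ n (F t) y ∂μ := funext ih
    have h1 : e (iteratedFDeriv ℝ (n + 1) Φ y) = fderiv ℝ (iteratedFDeriv ℝ n Φ) y := by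
      rw [fderiv_iteratedFDeriv]; rfl
    have h2 : ∫ t, fderiv ℝ (iteratedFDeriv ℝ n (F t)) y ∂μ =
        ∫ t, e (iteratedFDeriv ℝ (n + 1) (F t) y) ∂μ := by
      simp only [fderiv_iteratedFDeriv]; rfl
    apply e.injective
    rw [h1, hΦn, key.fderiv, h2]
    exact integral_comp_comm_linearIsometryEquiv (A := V [×(n + 1)]→L[ℝ] ℂ)
      (B := V →L[ℝ] (V [×n]→L[ℝ] ℂ)) (μ := μ) e (fun t ↦ iteratedFDeriv ℝ (n + 1) (F t) y)

theorem exists_finset_bound (u : 𝓢'(V, ℂ)) :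
    ∃ (s : Finset (ℕ × ℕ)) (C : ℝ), 0 ≤ C ∧
      ∀ φ, ‖u φ‖ ≤ C * s.sup (schwartzSeminormFamily ℂ V ℂ) φ := by
  have hc : Continuous ((normSeminorm ℂ ℂ).comp (u : 𝓢(V, ℂ) →ₗ[ℂ] ℂ)) :=
    continuous_norm.comp (map_continuous u)
  obtain ⟨s, C, -, h⟩ := Seminorm.bound_of_continuous (schwartz_withSeminorms ℂ V ℂ) _ hc
  exact ⟨s, C, C.2, fun φ ↦ h φ⟩

/-- A tempered distribution commutes with the weak integral of an integrable family of Schwartz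
functions. -/
theorem apply_eq_integral (u : 𝓢'(V, ℂ)) (hF : Continuous F)
    (hb : ∀ k n, ∃ b : T → ℝ, Integrable b μ ∧ ∀ t, SchwartzMap.seminorm ℂ k n (F t) ≤ b t)
    (hΦ : ∀ y, Φ y = ∫ t, F t y ∂μ) :
    Integrable (fun t ↦ u (F t)) μ ∧ u Φ = ∫ t, u (F t) ∂μ := by
  obtain ⟨s, C, hC, hs⟩ := exists_finset_bound u
  -- The index `(0, 0)` adds the sup norm of `φ` itself, which makes `J` injective.
  let s' := insert (0, 0) s
  let J : 𝓢(V, ℂ) →L[ℂ] ((i : s') → BoundedMultilinear V i.1.2) :=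
    ContinuousLinearMap.pi fun i ↦ weightedDeriv i.1.1 i.1.2
  have hJint : Integrable (fun t ↦ J (F t)) μ :=
    Integrable.of_eval fun i ↦ integrable_weightedDeriv hF hb _ _
  have hJΦ : J Φ = ∫ t, J (F t) ∂μ := by
    ext1 i
    refine BoundedMultilinear.eval_ext fun y ↦ ?_
    let ev := (BoundedMultilinear.eval i.1.2 y).comp
      (ContinuousLinearMap.proj (R := ℂ)
        (φ := fun i : s' ↦ BoundedMultilinear V i.1.2) i)
    change ev (J Φ) = ev (∫ t, J (F t) ∂μ)
    rw [← ev.integral_comp_comm hJint]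
    change (‖y‖ ^ i.1.1 : ℝ) • iteratedFDeriv ℝ i.1.2 Φ y =
      ∫ t, (‖y‖ ^ i.1.1 : ℝ) • iteratedFDeriv ℝ i.1.2 (F t) y ∂μ
    rw [integral_smul, iteratedFDeriv_eq_integral hF hb hΦ]
  have hbound : ∀ φ, ‖u φ‖ ≤ C * ‖J φ‖ := fun φ ↦ by
    refine (hs φ).trans (mul_le_mul_of_nonneg_left ?_ hC)
    refine Seminorm.finset_sup_apply_le (norm_nonneg _) fun i hi ↦ ?_
    exact (seminorm_le_norm_weightedDeriv i.1 i.2 φ).trans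
      (norm_le_pi_norm (J φ) ⟨i, Finset.mem_insert_of_mem hi⟩)
  have hker : LinearMap.ker J.toLinearMap = ⊥ := by
    refine LinearMap.ker_eq_bot'.2 fun φ hφ ↦ ?_
    ext y
    have h0 := (seminorm_le_norm_weightedDeriv 0 0 φ).trans
      (norm_le_pi_norm (J φ) ⟨(0, 0), Finset.mem_insert_self _ _⟩)
    have h1 : J φ = 0 := hφ
    rw [h1, norm_zero] at h0
    simpa using (φ.norm_le_seminorm ℂ y).trans h0
  -- The goal is a factorisation `u = ℓ ∘ J` through a Banach space. The inverse `r` is only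
  -- algebraic; `hbound` supplies the continuity of `u ∘ r` on the range of `J`, and a Hahn–Banach
  -- extension gives `ℓ`.
  obtain ⟨r, hr⟩ := LinearMap.exists_leftInverse_of_injective _ hker
  have hrJ : ∀ φ, r (J φ) = φ := fun φ ↦ LinearMap.congr_fun hr φ
  let S := LinearMap.range J.toLinearMap
  let ℓ₀ : S →L[ℂ] ℂ := LinearMap.mkContinuous
    (((u : 𝓢(V, ℂ) →ₗ[ℂ] ℂ).comp r).domRestrict S) C (by
      rintro ⟨_, φ, rfl⟩
      change ‖u (r (J φ))‖ ≤ C * ‖J φ‖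
      rw [hrJ]
      exact hbound φ)
  obtain ⟨ℓ, hℓ⟩ := ℓ₀.exist_extension_of_finiteDimensional_range
  have hℓJ : ∀ φ, u φ = ℓ (J φ) := fun φ ↦ by
    have h := DFunLike.congr_fun hℓ ⟨J φ, φ, rfl⟩
    change u (r (J φ)) = ℓ (J φ) at h
    rwa [hrJ] at h
  simp only [hℓJ]
  exact ⟨ℓ.integrable_comp hJint, by rw [hJΦ, ℓ.integral_comp_comm hJint]⟩

end WeakIntegral

/-! ### Seminorms of time-frequency shifts -/

section Shift

variable {V : Type*} [NormedAddCommGroup V] [InnerProductSpace ℝ V]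

theorem norm_character (ξ y : V) : ‖character ξ y‖ = 1 := by
  have : 2 * (Real.pi : ℂ) * Complex.I * ((inner ℝ ξ y : ℝ) : ℂ) =
      ((2 * Real.pi * inner ℝ ξ y : ℝ) : ℂ) * Complex.I := by push_cast; ring
  rw [character, this, Complex.norm_exp_ofReal_mul_I]

theorem conj_character (ξ y : V) : conj (character ξ y) = character (-ξ) y := by
  rw [character, character, ← Complex.exp_conj]
  congr 1
  simp [map_ofNat]

/-- The character is `exp (2πi ·)` composed with a linear form of norm `‖ξ‖`, so each derivative
costs one factor `2π‖ξ‖`. -/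
theorem norm_iteratedFDeriv_character_le (ξ : V) (n : ℕ) (y : V) :
    ‖iteratedFDeriv ℝ n (character ξ) y‖ ≤ (2 * Real.pi * ‖ξ‖) ^ n := by
  let e : ℝ → ℂ := fun t ↦ Complex.exp (2 * Real.pi * Complex.I * (t : ℂ))
  have he : ContDiff ℝ ∞ e :=
    Complex.contDiff_exp.comp (contDiff_const.mul Complex.ofRealCLM.contDiff)
  have hc : character ξ = e ∘ (innerSL ℝ ξ) := rfl
  have hn : ‖iteratedFDeriv ℝ n e (innerSL ℝ ξ y)‖ ≤ (2 * Real.pi) ^ n := by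
    rw [norm_iteratedFDeriv_eq_norm_iteratedDeriv, iteratedDeriv_cexp_real, norm_mul]
    have : 2 * (Real.pi : ℂ) * Complex.I * ((innerSL ℝ ξ y : ℝ) : ℂ) =
      ((2 * Real.pi * innerSL ℝ ξ y : ℝ) : ℂ) * Complex.I := by push_cast; ring
    rw [this, Complex.norm_exp_ofReal_mul_I]
    simp [abs_of_pos Real.pi_pos]
  rw [hc, (innerSL ℝ ξ).iteratedFDeriv_comp_right he y (by exact_mod_cast le_top)]
  refine (ContinuousMultilinearMap.norm_compContinuousLinearMap_le _ _).trans ?_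
  rw [Finset.prod_const, Finset.card_univ, Fintype.card_fin, innerSL_apply_norm, mul_pow]
  gcongr

theorem timeFreqShift_apply' (x ξ : V) (g : 𝓢(V, ℂ)) (y : V) :
    timeFreqShift x ξ g y = character ξ y * g (y - x) := timeFreqShift_apply x ξ g y

theorem norm_timeFreqShift_apply (x ξ : V) (g : 𝓢(V, ℂ)) (y : V) :
    ‖timeFreqShift x ξ g y‖ = ‖g (y - x)‖ := by
  rw [timeFreqShift_apply', norm_mul, norm_character, one_mul]

theorem conjSchwartz_timeFreqShift (x ξ : V) (g : 𝓢(V, ℂ)) :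
    conjSchwartz (timeFreqShift x ξ g) = timeFreqShift x (-ξ) (conjSchwartz g) := by
  ext y
  simp [timeFreqShift_apply', conj_character]

@[simp]
theorem conjSchwartz_conjSchwartz (g : 𝓢(V, ℂ)) : conjSchwartz (conjSchwartz g) = g := by
  ext y
  simp

theorem continuous_conjSchwartz : Continuous (conjSchwartz : 𝓢(V, ℂ) → 𝓢(V, ℂ)) :=
  (SchwartzMap.postcompCLM (𝕜 := ℝ) (Complex.conjCLE : ℂ →L[ℝ] ℂ)).continuous

theorem seminorm_conjSchwartz_le (k n : ℕ) (φ : 𝓢(V, ℂ)) :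
    SchwartzMap.seminorm ℂ k n (conjSchwartz φ) ≤ SchwartzMap.seminorm ℂ k n φ := by
  refine SchwartzMap.seminorm_le_bound ℂ k n _ (apply_nonneg _ _) fun y ↦ ?_
  have : ‖iteratedFDeriv ℝ n (conjSchwartz φ) y‖ = ‖iteratedFDeriv ℝ n φ y‖ :=
    Complex.conjLIE.norm_iteratedFDeriv_comp_left (f := φ) y n
  rw [this]
  exact φ.le_seminorm ℂ k n y

/-- Submultiplicativity of the weight: it trades a weight at `y` for one at the centre `x` and one
that the decay of the translated window absorbs. -/
theorem one_add_norm_pow_le_mul {V : Type*} [NormedAddCommGroup V] (x y : V) (k : ℕ) :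
    (1 + ‖y‖) ^ k ≤ (1 + ‖x‖) ^ k * (1 + ‖y - x‖) ^ k := by
  rw [← mul_pow]
  gcongr
  have : ‖y‖ ≤ ‖x‖ + ‖y - x‖ := by simpa using norm_add_le x (y - x)
  nlinarith [mul_nonneg (norm_nonneg x) (norm_nonneg (y - x))]

theorem iteratedFDeriv_compSubConst (g : 𝓢(V, ℂ)) (x y : V) (n : ℕ) :
    iteratedFDeriv ℝ n (SchwartzMap.compSubConstCLM ℂ x g) y = iteratedFDeriv ℝ n g (y - x) :=
  iteratedFDeriv_comp_sub n x y

/-- The Schwartz seminorms of `π(x, ξ) g` grow at most polynomially in `(x, ξ)`. -/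
theorem exists_seminorm_timeFreqShift_le (g : 𝓢(V, ℂ)) (k n : ℕ) :
    ∃ C : ℝ, 0 ≤ C ∧ ∀ x ξ, SchwartzMap.seminorm ℂ k n (timeFreqShift x ξ g) ≤
      C * ((1 + ‖x‖) ^ k * (1 + ‖ξ‖) ^ n) := by
  choose D hD0 hD using fun i ↦ decay_one_add g k i
  refine ⟨∑ i ∈ Finset.range (n + 1), (n.choose i : ℝ) * (2 * Real.pi) ^ n * D (n - i),
    Finset.sum_nonneg fun i _ ↦ mul_nonneg (by positivity) (hD0 _), fun x ξ ↦ ?_⟩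
  refine SchwartzMap.seminorm_le_bound ℂ k n _ (mul_nonneg (Finset.sum_nonneg fun i _ ↦
    mul_nonneg (by positivity) (hD0 _)) (by positivity)) fun y ↦ ?_
  have hcd : ContDiff ℝ ∞ (character ξ) := (hasTemperateGrowth_character ξ).1
  have hleib := norm_iteratedFDeriv_mul_le hcd ((SchwartzMap.compSubConstCLM ℂ x g).smooth ⊤) y
    (n := n) (by exact_mod_cast le_top)
  have hfun : (timeFreqShift x ξ g : V → ℂ) =
      fun y ↦ character ξ y * SchwartzMap.compSubConstCLM ℂ x g y := by
    ext y; exact timeFreqShift_apply' x ξ g y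
  rw [hfun]
  have h2pi : 1 ≤ 2 * Real.pi := by linarith [Real.two_le_pi]
  calc ‖y‖ ^ k * _ ≤ (1 + ‖y‖) ^ k * ∑ i ∈ Finset.range (n + 1), (n.choose i : ℝ) *
        ‖iteratedFDeriv ℝ i (character ξ) y‖ *
        ‖iteratedFDeriv ℝ (n - i) (SchwartzMap.compSubConstCLM ℂ x g) y‖ := by
        gcongr
        linarith
    _ ≤ ((1 + ‖x‖) ^ k * (1 + ‖y - x‖) ^ k) * ∑ i ∈ Finset.range (n + 1), (n.choose i : ℝ) *
        ((2 * Real.pi) ^ n * (1 + ‖ξ‖) ^ n) * ‖iteratedFDeriv ℝ (n - i) g (y - x)‖ := by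
        gcongr with i hi
        · exact one_add_norm_pow_le_mul x y k
        · refine (norm_iteratedFDeriv_character_le ξ i y).trans ?_
          rw [← mul_pow]
          -- A base of at least `1` lets every exponent `i ≤ n` be raised to `n`.
          have h1 : 1 ≤ 2 * Real.pi * (1 + ‖ξ‖) := by nlinarith [norm_nonneg ξ]
          calc (2 * Real.pi * ‖ξ‖) ^ i ≤ (2 * Real.pi * (1 + ‖ξ‖)) ^ i := by gcongr; linarith
            _ ≤ _ := pow_le_pow_right₀ h1 (Nat.lt_succ_iff.1 (Finset.mem_range.1 hi))
        · rw [iteratedFDeriv_compSubConst]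
    _ = ∑ i ∈ Finset.range (n + 1), (n.choose i : ℝ) * (2 * Real.pi) ^ n *
        ((1 + ‖y - x‖) ^ k * ‖iteratedFDeriv ℝ (n - i) g (y - x)‖) *
          ((1 + ‖x‖) ^ k * (1 + ‖ξ‖) ^ n) := by
        rw [Finset.mul_sum]
        exact Finset.sum_congr rfl fun i _ ↦ by ring
    _ ≤ _ := by
        rw [Finset.sum_mul]
        gcongr with i hi
        exact hD _ _

end Shift

/-! ### Continuity of time-frequency shifts in the Schwartz topology -/

section Continuity

/-- A family of Schwartz functions is continuous if all its derivatives are jointly continuous and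
its seminorms are locally bounded. -/
theorem continuous_schwartz_family {V T : Type*} [NormedAddCommGroup V] [NormedSpace ℝ V]
    [FiniteDimensional ℝ V] [TopologicalSpace T] {F : T → 𝓢(V, ℂ)}
    (hj : ∀ n, Continuous fun p : T × V ↦ iteratedFDeriv ℝ n (F p.1) p.2)
    (hb : ∀ k n t₀, ∃ C, ∀ᶠ t in 𝓝 t₀, SchwartzMap.seminorm ℂ k n (F t) ≤ C) :
    Continuous F := by
  rw [continuous_iff_continuousAt]
  intro t₀
  refine ((schwartz_withSeminorms ℂ V ℂ).tendsto_nhds F (F t₀)).2 ?_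
  rintro ⟨k, n⟩ ε hε
  -- One extra power of `‖y‖` makes the tail outside a large ball uniformly small.
  obtain ⟨C, hC⟩ := hb (k + 1) n t₀
  have hC0 : 0 ≤ C := (apply_nonneg _ _).trans hC.self_of_nhds
  have hsub : ∀ t y, iteratedFDeriv ℝ n (F t - F t₀) y =
      iteratedFDeriv ℝ n (F t) y - iteratedFDeriv ℝ n (F t₀) y := fun t y ↦
    iteratedFDeriv_sub_apply ((F t).smooth n).contDiffAt ((F t₀).smooth n).contDiffAt
  -- Chosen so that `2 * C ≤ R * (ε / 2)`; the summand `1` keeps `R` positive when `C = 0`.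
  let R : ℝ := 4 * C / ε + 1
  have hR : 0 < R := by positivity
  let H : T × V → ℝ := fun p ↦
    ‖p.2‖ ^ k * ‖iteratedFDeriv ℝ n (F p.1) p.2 - iteratedFDeriv ℝ n (F t₀) p.2‖
  have hH : Continuous H := by
    have h1 : Continuous fun p : T × V ↦ iteratedFDeriv ℝ n (F t₀) p.2 :=
      (hj n).comp (continuous_const.prodMk continuous_snd)
    exact (continuous_snd.norm.pow k).mul ((hj n).sub h1).norm
  -- On the compact ball, `H` vanishes at `t = t₀`, so the tube lemma makes it small for all nearby
  -- `t` uniformly in `y`.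
  obtain ⟨u, v, hu, -, hu₀, hv, huv⟩ := generalized_tube_lemma (isCompact_singleton (x := t₀))
    (isCompact_closedBall (0 : V) R) (isOpen_Iio.preimage hH : IsOpen (H ⁻¹' Set.Iio (ε / 2))) (by
      rintro ⟨t, y⟩ ⟨rfl, -⟩
      simp only [Set.mem_preimage, Set.mem_Iio, H, sub_self, norm_zero, mul_zero]
      positivity)
  filter_upwards [hC, hu.mem_nhds (hu₀ rfl)] with t ht htu
  refine lt_of_le_of_lt (SchwartzMap.seminorm_le_bound ℂ k n _ (half_pos hε).le fun y ↦ ?_)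
    (half_lt_self hε)
  have hy' : iteratedFDeriv ℝ n (⇑(F t - F t₀)) y =
      iteratedFDeriv ℝ n (F t) y - iteratedFDeriv ℝ n (F t₀) y := hsub t y
  rw [hy']
  by_cases hy : y ∈ Metric.closedBall (0 : V) R
  · exact (huv ⟨htu, hv hy⟩ : H (t, y) < ε / 2).le
  · have hRy : R < ‖y‖ := by simpa using hy
    have h1 := (F t).le_seminorm ℂ (k + 1) n y
    have h2 := (F t₀).le_seminorm ℂ (k + 1) n y
    have h3 := hC.self_of_nhds
    have h4 : ‖y‖ * (‖y‖ ^ k * ‖iteratedFDeriv ℝ n (F t) y - iteratedFDeriv ℝ n (F t₀) y‖) ≤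
        2 * C := by
      calc _ ≤ ‖y‖ * (‖y‖ ^ k * (‖iteratedFDeriv ℝ n (F t) y‖ +
            ‖iteratedFDeriv ℝ n (F t₀) y‖)) := by gcongr; exact norm_sub_le _ _
        _ = ‖y‖ ^ (k + 1) * ‖iteratedFDeriv ℝ n (F t) y‖ +
            ‖y‖ ^ (k + 1) * ‖iteratedFDeriv ℝ n (F t₀) y‖ := by ring
        _ ≤ 2 * C := by linarith
    have h5 : R * (‖y‖ ^ k * ‖iteratedFDeriv ℝ n (F t) y - iteratedFDeriv ℝ n (F t₀) y‖) ≤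
        2 * C := le_trans (by gcongr) h4
    have h6 : 2 * C ≤ R * (ε / 2) := by
      have : R * (ε / 2) = 2 * C + ε / 2 := by simp only [R]; field_simp; ring
      linarith
    exact le_of_mul_le_mul_left (h5.trans h6) hR

variable {V : Type*} [NormedAddCommGroup V] [InnerProductSpace ℝ V]

/-- The shifted window is jointly smooth in position, frequency and `y`; derivatives in `y` alone
are restrictions of the full derivatives to the last factor. -/
theorem continuous_iteratedFDeriv_timeFreqShift (g : 𝓢(V, ℂ)) (n : ℕ) :
    Continuous fun p : (V × V) × V ↦
      iteratedFDeriv ℝ n (timeFreqShift p.1.1 p.1.2 g) p.2 := by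
  let G : (V × V) × V → ℂ := fun p ↦
    Complex.exp (2 * Real.pi * Complex.I * (inner ℝ p.1.2 p.2 : ℝ)) * g (p.2 - p.1.1)
  have hG : ContDiff ℝ ∞ G := by
    have h1 : ContDiff ℝ ∞ fun p : (V × V) × V ↦ (inner ℝ p.1.2 p.2 : ℝ) :=
      (contDiff_snd.comp contDiff_fst).inner ℝ contDiff_snd
    have h2 : ContDiff ℝ ∞ fun p : (V × V) × V ↦ g (p.2 - p.1.1) :=
      (g.smooth ⊤).comp (contDiff_snd.sub (contDiff_fst.comp contDiff_fst))
    exact (Complex.contDiff_exp.comp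
      (contDiff_const.mul (Complex.ofRealCLM.contDiff.comp h1))).mul h2
  have key : ∀ p : (V × V) × V, iteratedFDeriv ℝ n (timeFreqShift p.1.1 p.1.2 g) p.2 =
      (iteratedFDeriv ℝ n G p).compContinuousLinearMap
        fun _ ↦ ContinuousLinearMap.inr ℝ (V × V) V := by
    rintro ⟨z, y⟩
    have hfun : (timeFreqShift z.1 z.2 g : V → ℂ) =
        (fun q ↦ G ((z, 0) + q)) ∘ ContinuousLinearMap.inr ℝ (V × V) V := by
      ext y; simp [G, timeFreqShift_apply]
    have hG' : ContDiff ℝ ∞ fun q ↦ G ((z, 0) + q) := hG.comp (contDiff_const.add contDiff_id)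
    rw [hfun, ContinuousLinearMap.iteratedFDeriv_comp_right _ hG' y (by exact_mod_cast le_top),
      iteratedFDeriv_comp_add_left]
    simp
  simp only [key]
  exact (ContinuousMultilinearMap.compContinuousLinearMapL
    (fun _ : Fin n ↦ ContinuousLinearMap.inr ℝ (V × V) V)).continuous.comp
    (hG.continuous_iteratedFDeriv (by exact_mod_cast le_top))

theorem continuous_timeFreqShift [FiniteDimensional ℝ V] (g : 𝓢(V, ℂ)) :
    Continuous fun z : V × V ↦ timeFreqShift z.1 z.2 g := by
  refine continuous_schwartz_family (continuous_iteratedFDeriv_timeFreqShift g) fun k n z₀ ↦ ?_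
  obtain ⟨C, -, hC⟩ := exists_seminorm_timeFreqShift_le g k n
  have hcont : Continuous fun z : V × V ↦ C * ((1 + ‖z.1‖) ^ k * (1 + ‖z.2‖) ^ n) := by fun_prop
  refine ⟨C * ((1 + ‖z₀.1‖) ^ k * (1 + ‖z₀.2‖) ^ n) + 1, ?_⟩
  filter_upwards [hcont.continuousAt.eventually_lt continuousAt_const (lt_add_one _)] with z hz
  exact (hC z.1 z.2).trans hz.le

theorem continuous_stft [FiniteDimensional ℝ V] (g : 𝓢(V, ℂ)) (u : 𝓢'(V, ℂ)) :
    Continuous (stft g u) :=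
  (map_continuous u).comp (continuous_conjSchwartz.comp (continuous_timeFreqShift g))

end Continuity

/-! ### Weak integrals under the sesquilinear bracket -/

section Bracket

variable {V : Type*} [NormedAddCommGroup V] [InnerProductSpace ℝ V]
  {T : Type*} [TopologicalSpace T] [SecondCountableTopology T] [MeasurableSpace T]
  [OpensMeasurableSpace T] {μ : Measure T} {F : T → 𝓢(V, ℂ)} {Φ : 𝓢(V, ℂ)}

theorem bracket_smul (u : 𝓢'(V, ℂ)) (c : ℂ) (φ : 𝓢(V, ℂ)) :
    bracket u (c • φ) = conj c * bracket u φ := by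
  have : conjSchwartz (c • φ) = conj c • conjSchwartz φ := by ext y; simp
  rw [bracket, this, map_smul, smul_eq_mul, bracket]

/-- The bracket commutes with the weak integral of an integrable family of Schwartz functions. -/
theorem bracket_eq_integral (u : 𝓢'(V, ℂ)) (hF : Continuous F)
    (hb : ∀ k n, ∃ b : T → ℝ, Integrable b μ ∧ ∀ t, SchwartzMap.seminorm ℂ k n (F t) ≤ b t)
    (hΦ : ∀ y, Φ y = ∫ t, F t y ∂μ) :
    Integrable (fun t ↦ bracket u (F t)) μ ∧ bracket u Φ = ∫ t, bracket u (F t) ∂μ := by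
  refine apply_eq_integral u (continuous_conjSchwartz.comp hF) (fun k n ↦ ?_) fun y ↦ ?_
  · obtain ⟨b, hb, hle⟩ := hb k n
    exact ⟨b, hb, fun t ↦ (seminorm_conjSchwartz_le k n _).trans (hle t)⟩
  · simp only [conjSchwartz_apply, hΦ]
    exact integral_conj.symm

end Bracket

/-! ### Decay and inversion of the short-time Fourier transform of Schwartz functions -/

section Decay

variable {V : Type*} [NormedAddCommGroup V] [InnerProductSpace ℝ V]

/-- The windowed function `y ↦ g y * conj (γ (y - x))`. -/
def windowed (γ g : 𝓢(V, ℂ)) (x : V) : 𝓢(V, ℂ) :=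
  SchwartzMap.smulLeftCLM ℂ (conjSchwartz (SchwartzMap.compSubConstCLM ℂ x γ)) g

theorem windowed_apply (γ g : 𝓢(V, ℂ)) (x y : V) :
    windowed γ g x y = conj (γ (y - x)) * g y := by
  rw [windowed, SchwartzMap.smulLeftCLM_apply_apply (SchwartzMap.hasTemperateGrowth _)]
  simp

theorem norm_iteratedFDeriv_conjSchwartz (φ : 𝓢(V, ℂ)) (n : ℕ) (y : V) :
    ‖iteratedFDeriv ℝ n (conjSchwartz φ) y‖ = ‖iteratedFDeriv ℝ n φ y‖ :=
  Complex.conjLIE.norm_iteratedFDeriv_comp_left (f := φ) y n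

/-- At each `y`, either `y` or `y - x` is large when `x` is, so the decay of `g` and `γ` together
absorbs any power of `1 + ‖x‖`. -/
theorem exists_seminorm_windowed_le (γ g : 𝓢(V, ℂ)) (N k n : ℕ) :
    ∃ C : ℝ, 0 ≤ C ∧ ∀ x, (1 + ‖x‖) ^ N * SchwartzMap.seminorm ℂ k n (windowed γ g x) ≤ C := by
  choose D hD0 hD using fun i ↦ decay_one_add γ N i
  choose D' hD'0 hD' using fun i ↦ decay_one_add g (N + k) i
  refine ⟨∑ i ∈ Finset.range (n + 1), (n.choose i : ℝ) * D i * D' (n - i),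
    Finset.sum_nonneg fun i _ ↦ mul_nonneg (mul_nonneg (by positivity) (hD0 _)) (hD'0 _),
    fun x ↦ ?_⟩
  have hx : 0 < (1 + ‖x‖) ^ N := by positivity
  rw [← le_div_iff₀' hx]
  refine SchwartzMap.seminorm_le_bound ℂ k n _ (div_nonneg (Finset.sum_nonneg fun i _ ↦
    mul_nonneg (mul_nonneg (by positivity) (hD0 _)) (hD'0 _)) hx.le) fun y ↦ ?_
  rw [le_div_iff₀' hx]
  let h := conjSchwartz (SchwartzMap.compSubConstCLM ℂ x γ)
  have hfun : (windowed γ g x : V → ℂ) = fun y ↦ h y * g y := by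
    ext y; exact windowed_apply γ g x y
  have hh : ∀ i, ‖iteratedFDeriv ℝ i h y‖ = ‖iteratedFDeriv ℝ i γ (y - x)‖ := fun i ↦ by
    rw [norm_iteratedFDeriv_conjSchwartz, iteratedFDeriv_compSubConst]
  have hleib := norm_iteratedFDeriv_mul_le (h.smooth ⊤) (g.smooth ⊤) y
    (n := n) (by exact_mod_cast le_top)
  have hxy : (1 + ‖x‖) ^ N ≤ (1 + ‖y‖) ^ N * (1 + ‖y - x‖) ^ N := by
    rw [norm_sub_rev]; exact one_add_norm_pow_le_mul y x N
  rw [hfun]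
  calc (1 + ‖x‖) ^ N * (‖y‖ ^ k * _) ≤ ((1 + ‖y‖) ^ N * (1 + ‖y - x‖) ^ N) *
        ((1 + ‖y‖) ^ k * ∑ i ∈ Finset.range (n + 1), (n.choose i : ℝ) *
          ‖iteratedFDeriv ℝ i h y‖ * ‖iteratedFDeriv ℝ (n - i) g y‖) := by
        gcongr
        linarith
    _ = ∑ i ∈ Finset.range (n + 1), (n.choose i : ℝ) *
        ((1 + ‖y - x‖) ^ N * ‖iteratedFDeriv ℝ i γ (y - x)‖) *
        ((1 + ‖y‖) ^ (N + k) * ‖iteratedFDeriv ℝ (n - i) g y‖) := by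
        simp only [hh]
        rw [Finset.mul_sum, Finset.mul_sum]
        exact Finset.sum_congr rfl fun i _ ↦ by ring
    _ ≤ _ := by
        gcongr with i hi
        · exact mul_nonneg (by positivity) (hD0 i)
        · exact hD _ _
        · exact hD' _ _

variable [FiniteDimensional ℝ V] [MeasurableSpace V] [BorelSpace V]

/-- Continuity of the Fourier transform on the Schwartz space bounds the decay in `ξ` by finitely
many seminorms of the windowed function, and these decay in `x`. -/
theorem exists_norm_fourier_windowed_le (γ g : 𝓢(V, ℂ)) (N : ℕ) :
    ∃ C : ℝ, 0 ≤ C ∧ ∀ x ξ,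
      (1 + ‖x‖) ^ N * (1 + ‖ξ‖) ^ N * ‖𝓕 (windowed γ g x) ξ‖ ≤ C := by
  let q : Seminorm ℂ 𝓢(V, ℂ) :=
    ((Finset.Iic (N, 0)).sup fun m : ℕ × ℕ ↦ SchwartzMap.seminorm ℂ m.1 m.2).comp
      (SchwartzMap.fourierTransformCLM ℂ : 𝓢(V, ℂ) →L[ℂ] 𝓢(V, ℂ)).toLinearMap
  have hsup : Continuous ((Finset.Iic (N, 0)).sup
      fun m : ℕ × ℕ ↦ SchwartzMap.seminorm ℂ m.1 m.2 : Seminorm ℂ 𝓢(V, ℂ)) :=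
    Finset.sup_induction (p := fun q : Seminorm ℂ 𝓢(V, ℂ) ↦ Continuous q) continuous_const
      (fun _ h₁ _ h₂ ↦ h₁.sup h₂) fun i _ ↦ (schwartz_withSeminorms ℂ V ℂ).continuous_seminorm i
  have hq : Continuous q := hsup.comp (SchwartzMap.fourierTransformCLM ℂ).continuous
  obtain ⟨s, B, -, hB⟩ := Seminorm.bound_of_continuous (schwartz_withSeminorms ℂ V ℂ) q hq
  choose D hD0 hD using fun i : ℕ × ℕ ↦ exists_seminorm_windowed_le γ g N i.1 i.2
  refine ⟨2 ^ N * (B * ∑ i ∈ s, D i), mul_nonneg (by positivity)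
    (mul_nonneg B.2 (Finset.sum_nonneg fun i _ ↦ hD0 i)), fun x ξ ↦ ?_⟩
  have hx : 0 < (1 + ‖x‖) ^ N := by positivity
  have h1 := SchwartzMap.one_add_le_sup_seminorm_apply (𝕜 := ℂ) (m := (N, 0)) (k := N) (n := 0)
    le_rfl le_rfl (𝓕 (windowed γ g x)) ξ
  rw [norm_iteratedFDeriv_zero] at h1
  have h2 : q (windowed γ g x) ≤ B * s.sup (schwartzSeminormFamily ℂ V ℂ) (windowed γ g x) :=
    hB _
  have h3 : s.sup (schwartzSeminormFamily ℂ V ℂ) (windowed γ g x) ≤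
      (∑ i ∈ s, D i) / (1 + ‖x‖) ^ N := by
    refine Seminorm.finset_sup_apply_le (div_nonneg (Finset.sum_nonneg fun i _ ↦ hD0 i) hx.le)
      fun i hi ↦ ?_
    rw [le_div_iff₀' hx]
    exact (hD i x).trans (Finset.single_le_sum (fun i _ ↦ hD0 i) hi)
  calc (1 + ‖x‖) ^ N * (1 + ‖ξ‖) ^ N * ‖𝓕 (windowed γ g x) ξ‖
      = (1 + ‖x‖) ^ N * ((1 + ‖ξ‖) ^ N * ‖𝓕 (windowed γ g x) ξ‖) := by ring
    _ ≤ (1 + ‖x‖) ^ N * (2 ^ N * (B * ((∑ i ∈ s, D i) / (1 + ‖x‖) ^ N))) := by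
        refine mul_le_mul_of_nonneg_left (h1.trans ?_) hx.le
        refine mul_le_mul_of_nonneg_left (h2.trans ?_) (by positivity)
        exact mul_le_mul_of_nonneg_left h3 B.2
    _ = _ := by field_simp

/-- The short-time Fourier transform of a Schwartz function. -/
def schwartzStft (γ g : 𝓢(V, ℂ)) (z : V × V) : ℂ := 𝓕 (windowed γ g z.1) z.2

theorem schwartzStft_eq_integral (γ g : 𝓢(V, ℂ)) (z : V × V) :
    schwartzStft γ g z = ∫ y, conj (timeFreqShift z.1 z.2 γ y) * g y := by
  rw [schwartzStft, SchwartzMap.fourier_coe, Real.fourier_eq']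
  congr 1
  ext y
  have h : ((-2 * Real.pi * inner ℝ y z.2 : ℝ) : ℂ) * Complex.I =
      2 * Real.pi * Complex.I * ((inner ℝ (-z.2) y : ℝ) : ℂ) := by
    rw [inner_neg_left, real_inner_comm]
    push_cast
    ring
  rw [windowed_apply, timeFreqShift_apply', map_mul, conj_character, character, smul_eq_mul,
    ← h, ← mul_assoc, mul_assoc (-2 : ℝ)]

/-- Inherited from `continuous_stft`, with `g` regarded as a tempered distribution. -/
theorem continuous_schwartzStft (γ g : 𝓢(V, ℂ)) : Continuous (schwartzStft γ g) := by
  have h := continuous_stft γ (SchwartzMap.toTemperedDistributionCLM V ℂ volume g)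
  convert h using 1
  ext z
  rw [schwartzStft_eq_integral]
  exact (SchwartzMap.toTemperedDistributionCLM_apply_apply volume g
    (conjSchwartz (timeFreqShift z.1 z.2 γ))).symm

theorem integrable_one_add_norm_prod :
    ∃ r : ℕ, Integrable fun z : V × V ↦ ((1 + ‖z.1‖) ^ r)⁻¹ * ((1 + ‖z.2‖) ^ r)⁻¹ := by
  refine ⟨(volume : Measure V).integrablePower, ?_⟩
  have h : Integrable fun x : V ↦ ((1 + ‖x‖) ^ (volume : Measure V).integrablePower)⁻¹ := by
    convert Measure.integrable_pow_neg_integrablePower (volume : Measure V) using 2 with x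
    rw [Real.rpow_neg (by positivity), Real.rpow_natCast]
  exact h.mul_prod h

/-- The short-time Fourier transform of a Schwartz function is integrable against every
polynomial weight. -/
theorem exists_integrable_bound_schwartzStft (γ g : 𝓢(V, ℂ)) (k n : ℕ) :
    ∃ b : V × V → ℝ, Integrable b ∧
      ∀ z, ‖schwartzStft γ g z‖ * ((1 + ‖z.1‖) ^ k * (1 + ‖z.2‖) ^ n) ≤ b z := by
  obtain ⟨r, hr⟩ := integrable_one_add_norm_prod (V := V)
  -- The exponent pays for the weights `k` and `n` and leaves `r` powers in each variable for
  -- integrability.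
  obtain ⟨C, hC0, hC⟩ := exists_norm_fourier_windowed_le γ g (r + k + n)
  refine ⟨_, hr.const_mul C, fun z ↦ ?_⟩
  have h1 : 0 < (1 + ‖z.1‖) ^ r := by positivity
  have h2 : 0 < (1 + ‖z.2‖) ^ r := by positivity
  rw [← mul_inv, ← div_eq_mul_inv, le_div_iff₀ (by positivity)]
  refine le_trans ?_ (hC z.1 z.2)
  have e1 : (1 + ‖z.1‖) ^ r * (1 + ‖z.1‖) ^ k ≤ (1 + ‖z.1‖) ^ (r + k + n) := by
    rw [← pow_add]
    exact pow_le_pow_right₀ (by linarith [norm_nonneg z.1]) (by omega)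
  have e2 : (1 + ‖z.2‖) ^ r * (1 + ‖z.2‖) ^ n ≤ (1 + ‖z.2‖) ^ (r + k + n) := by
    rw [← pow_add]
    exact pow_le_pow_right₀ (by linarith [norm_nonneg z.2]) (by omega)
  calc ‖schwartzStft γ g z‖ * ((1 + ‖z.1‖) ^ k * (1 + ‖z.2‖) ^ n) *
        ((1 + ‖z.1‖) ^ r * (1 + ‖z.2‖) ^ r)
      = ((1 + ‖z.1‖) ^ r * (1 + ‖z.1‖) ^ k) * ((1 + ‖z.2‖) ^ r * (1 + ‖z.2‖) ^ n) *
        ‖schwartzStft γ g z‖ := by ring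
    _ ≤ (1 + ‖z.1‖) ^ (r + k + n) * (1 + ‖z.2‖) ^ (r + k + n) * ‖schwartzStft γ g z‖ := by
        gcongr
    _ = _ := rfl

theorem integrable_schwartzStft (γ g : 𝓢(V, ℂ)) : Integrable (schwartzStft γ g) := by
  obtain ⟨b, hb, hle⟩ := exists_integrable_bound_schwartzStft γ g 0 0
  exact hb.mono' (continuous_schwartzStft γ g).aestronglyMeasurable
    (ae_of_all _ fun z ↦ by simpa using hle z)

theorem integral_fourier_mul_character (φ : 𝓢(V, ℂ)) (y : V) :
    ∫ ξ, 𝓕 φ ξ * character ξ y = φ y := by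
  have h : 𝓕⁻ (𝓕 φ) y = φ y := by rw [FourierTransform.fourierInv_fourier_eq]
  rw [← h, SchwartzMap.fourierInv_coe, Real.fourierInv_eq']
  congr 1
  ext ξ
  rw [smul_eq_mul, mul_comm, character]
  congr 2
  push_cast
  ring

/-- The inversion formula for the short-time Fourier transform of a Schwartz function. -/
theorem integral_schwartzStft_smul (γ g : 𝓢(V, ℂ)) (y : V) :
    ∫ z, schwartzStft γ g z * timeFreqShift z.1 z.2 γ y =
      ((∫ x, ‖γ x‖ ^ 2 : ℝ) : ℂ) * g y := by
  have hint : Integrable (fun z : V × V ↦ schwartzStft γ g z * timeFreqShift z.1 z.2 γ y) := by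
    refine (integrable_schwartzStft γ g).mul_bdd (c := SchwartzMap.seminorm ℂ 0 0 γ) ?_ ?_
    · refine Continuous.aestronglyMeasurable ?_
      have hγ := γ.continuous
      simp only [timeFreqShift_apply]
      fun_prop
    · exact ae_of_all _ fun z ↦ by
        rw [norm_timeFreqShift_apply]; exact γ.norm_le_seminorm ℂ _
  rw [Measure.volume_eq_prod] at hint ⊢
  rw [integral_prod _ hint]
  -- For fixed `x` the frequency integral is Fourier inversion of the windowed function; the two
  -- copies of the window combine to `‖γ (y - x)‖ ^ 2`.
  have h1 : ∀ x : V, ∫ ξ, schwartzStft γ g (x, ξ) * timeFreqShift x ξ γ y =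
      ((‖γ (y - x)‖ ^ 2 : ℝ) : ℂ) * g y := fun x ↦ by
    calc ∫ ξ, schwartzStft γ g (x, ξ) * timeFreqShift x ξ γ y
        = ∫ ξ, (𝓕 (windowed γ g x) ξ * character ξ y) * γ (y - x) := by
          congr 1
          ext ξ
          rw [timeFreqShift_apply', schwartzStft]
          ring
      _ = windowed γ g x y * γ (y - x) := by
          rw [integral_mul_const, integral_fourier_mul_character]
      _ = _ := by
          rw [windowed_apply]
          push_cast
          rw [← Complex.conj_mul']
          ring
  simp only [h1]
  rw [integral_mul_const, integral_complex_ofReal,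
    integral_sub_left_eq_self (fun x ↦ ‖γ x‖ ^ 2) volume y]

end Decay

/-! ### The inversion formula under a tempered distribution -/

section Reconstruction

variable {V : Type*} [NormedAddCommGroup V] [InnerProductSpace ℝ V]

/-- The shift is moved onto the distribution by transposition, so the outer shift in `π(w)π(z)γ`
needs no estimates. The frequency changes sign because the bracket conjugates its test function. -/
theorem bracket_timeFreqShift (u : 𝓢'(V, ℂ)) (z : V × V) :
    ∃ u' : 𝓢'(V, ℂ), ∀ φ, bracket u (timeFreqShift z.1 z.2 φ) = bracket u' φ := by
  refine ⟨PointwiseConvergenceCLM.precomp ℂ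
    (SchwartzMap.smulLeftCLM ℂ (character (-z.2)) ∘L SchwartzMap.compSubConstCLM ℂ z.1) u,
    fun φ ↦ ?_⟩
  rw [bracket, conjSchwartz_timeFreqShift]
  rfl

variable [FiniteDimensional ℝ V] [MeasurableSpace V] [BorelSpace V]

/-- The inversion formula for the short-time Fourier transform, tested against a tempered
distribution. -/
theorem integral_schwartzStft_bracket (u : 𝓢'(V, ℂ)) (γ g : 𝓢(V, ℂ)) (w : V × V) :
    Integrable (fun z : V × V ↦ conj (schwartzStft γ g z) *
      bracket u (timeFreqShift w.1 w.2 (timeFreqShift z.1 z.2 γ))) ∧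
    ((∫ x, ‖γ x‖ ^ 2 : ℝ) : ℂ) * stft g u w =
      ∫ z : V × V, conj (schwartzStft γ g z) *
        bracket u (timeFreqShift w.1 w.2 (timeFreqShift z.1 z.2 γ)) := by
  obtain ⟨u', hu'⟩ := bracket_timeFreqShift u w
  simp only [stft, hu']
  have h := bracket_eq_integral (μ := (volume : Measure (V × V))) u'
    (F := fun z ↦ schwartzStft γ g z • timeFreqShift z.1 z.2 γ)
    (Φ := ((∫ x, ‖γ x‖ ^ 2 : ℝ) : ℂ) • g)
    ((continuous_schwartzStft γ g).smul (continuous_timeFreqShift γ)) (fun k n ↦ by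
      obtain ⟨C, hC0, hC⟩ := exists_seminorm_timeFreqShift_le γ k n
      obtain ⟨b, hb, hle⟩ := exists_integrable_bound_schwartzStft γ g k n
      refine ⟨_, hb.const_mul C, fun z ↦ ?_⟩
      rw [map_smul_eq_mul]
      calc _ ≤ ‖schwartzStft γ g z‖ * (C * ((1 + ‖z.1‖) ^ k * (1 + ‖z.2‖) ^ n)) := by
            gcongr; exact hC _ _
        _ = C * (‖schwartzStft γ g z‖ * ((1 + ‖z.1‖) ^ k * (1 + ‖z.2‖) ^ n)) := by ring
        _ ≤ _ := by gcongr; exact hle z)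
    (fun y ↦ by
      simp only [smul_apply, smul_eq_mul]
      exact (integral_schwartzStft_smul γ g y).symm)
  simp only [bracket_smul, Complex.conj_ofReal] at h
  exact h

end Reconstruction

/-! ### Shifts of tensor products -/

section Tensor

variable {V W : Type*} [NormedAddCommGroup V] [InnerProductSpace ℝ V]
  [NormedAddCommGroup W] [InnerProductSpace ℝ W]

/-- The inner product of the `L²` product splits, so the character factors. Iterated shifts of a
product window thus stay within the test functions on which a kernel is prescribed. -/
theorem timeFreqShift_tensor (x ξ : WithLp 2 (V × W)) (h : 𝓢(V, ℂ)) (f : 𝓢(W, ℂ)) :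
    timeFreqShift x ξ (tensor h f) =
      tensor (timeFreqShift x.fst ξ.fst h) (timeFreqShift x.snd ξ.snd f) := by
  ext y
  simp only [timeFreqShift_apply, tensor_apply]
  have : (inner ℝ ξ y : ℝ) = inner ℝ ξ.fst y.fst + inner ℝ ξ.snd y.snd :=
    WithLp.prod_inner_apply ξ y
  rw [this]
  push_cast
  rw [mul_add, Complex.exp_add]
  simp only [WithLp.sub_fst, WithLp.sub_snd]
  ring

end Tensor

/-! ### Invariance of the `L²` norm and nonzero windows -/

section Norm

variable {V : Type*} [NormedAddCommGroup V] [InnerProductSpace ℝ V]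
  [FiniteDimensional ℝ V] [MeasurableSpace V] [BorelSpace V]

theorem norm_toLp_timeFreqShift (x ξ : V) (g : 𝓢(V, ℂ)) :
    ‖(timeFreqShift x ξ g).toLp 2 (volume : Measure V)‖ = ‖g.toLp 2 (volume : Measure V)‖ := by
  rw [SchwartzMap.norm_toLp, SchwartzMap.norm_toLp,
    ← eLpNorm_comp_measurePreserving (g := g) (p := 2) g.continuous.aestronglyMeasurable
      (measurePreserving_sub_right (volume : Measure V) x)]
  congr 1
  exact eLpNorm_congr_norm_ae (ae_of_all _ fun y ↦ norm_timeFreqShift_apply x ξ g y)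

theorem norm_toLp_conjSchwartz (g : 𝓢(V, ℂ)) :
    ‖(conjSchwartz g).toLp 2 (volume : Measure V)‖ = ‖g.toLp 2 (volume : Measure V)‖ := by
  rw [SchwartzMap.norm_toLp, SchwartzMap.norm_toLp]
  congr 1
  exact eLpNorm_congr_norm_ae (ae_of_all _ fun y ↦ by simp)

theorem exists_schwartz_ne_zero (V : Type*) [NormedAddCommGroup V] [InnerProductSpace ℝ V]
    [FiniteDimensional ℝ V] : ∃ w : 𝓢(V, ℂ), w 0 ≠ 0 := by
  let b : ContDiffBump (0 : V) := ⟨1, 2, one_pos, one_lt_two⟩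
  have hc : HasCompactSupport (Complex.ofRealCLM ∘ b) := b.hasCompactSupport.comp_left rfl
  have hs : ContDiff ℝ ∞ (Complex.ofRealCLM ∘ b) := Complex.ofRealCLM.contDiff.comp b.contDiff
  refine ⟨hc.toSchwartzMap hs, ?_⟩
  change (b 0 : ℂ) ≠ 0
  rw [b.one_of_mem_closedBall (Metric.mem_closedBall_self b.rIn_pos.le)]
  simp

theorem integral_norm_sq_pos (γ : 𝓢(V, ℂ)) {x : V} (h : γ x ≠ 0) : 0 < ∫ x, ‖γ x‖ ^ 2 := by
  have hc : Continuous fun x ↦ ‖γ x‖ ^ 2 := γ.continuous.norm.pow 2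
  have hi : Integrable (fun x ↦ ‖γ x‖ ^ 2) volume :=
    (memLp_two_iff_integrable_sq_norm γ.continuous.aestronglyMeasurable).1 (γ.memLp 2)
  refine (integral_pos_iff_support_of_nonneg (fun _ ↦ by positivity) hi).2 ?_
  exact hc.isOpen_support.measure_pos _ ⟨x, by simpa using h⟩

end Norm

/-! ### Kernels of bounded operators and weak-* convergence -/

section Operator

variable {d : ℕ}

/-- The kernel identity conjugates the input of `A`; applying it to `conjSchwartz ψ` cancels this.
The inner product is antilinear in its first slot, which is why `φ` stands there. -/
theorem IsKernel.bracket_tensor {A : L2 d →L[ℂ] L2 d} {a : 𝓢'(Eucl2 d, ℂ)} (h : IsKernel A a)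
    (φ ψ : 𝓢(Eucl d, ℂ)) :
    bracket a (tensor φ ψ) = inner ℂ (φ.toLp 2) (A ((conjSchwartz ψ).toLp 2)) := by
  have h1 := h (conjSchwartz ψ) φ
  rw [conjSchwartz_conjSchwartz] at h1
  rw [← h1, bracket, Lp.toTemperedDistribution_apply, L2.inner_def]
  refine integral_congr_ae ?_
  filter_upwards [φ.coeFn_toLp 2 volume] with x hx
  rw [hx, conjSchwartz_apply, RCLike.inner_apply', smul_eq_mul]

theorem IsKernel.norm_bracket_tensor_le {A : L2 d →L[ℂ] L2 d} {a : 𝓢'(Eucl2 d, ℂ)}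
    (h : IsKernel A a) (φ ψ : 𝓢(Eucl d, ℂ)) :
    ‖bracket a (tensor φ ψ)‖ ≤ ‖A‖ * (‖φ.toLp 2 volume‖ * ‖ψ.toLp 2 volume‖) := by
  rw [h.bracket_tensor]
  calc _ ≤ ‖φ.toLp 2 volume‖ * ‖A ((conjSchwartz ψ).toLp 2)‖ := norm_inner_le_norm _ _
    _ ≤ ‖φ.toLp 2 volume‖ * (‖A‖ * ‖(conjSchwartz ψ).toLp 2 volume‖) := by
        gcongr; exact A.le_opNorm _
    _ = ‖A‖ * (‖φ.toLp 2 volume‖ * ‖ψ.toLp 2 volume‖) := by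
        rw [norm_toLp_conjSchwartz, mul_left_comm]

theorem tendsto_bracket_tensor {A_seq : ℕ → L2 d →L[ℂ] L2 d} {A : L2 d →L[ℂ] L2 d}
    {a_seq : ℕ → 𝓢'(Eucl2 d, ℂ)} {a : 𝓢'(Eucl2 d, ℂ)} (ha_seq : ∀ n, IsKernel (A_seq n) (a_seq n))
    (ha : IsKernel A a) (hA : ∀ f, Tendsto (fun n ↦ A_seq n f) atTop (𝓝 (A f)))
    (φ ψ : 𝓢(Eucl d, ℂ)) :
    Tendsto (fun n ↦ bracket (a_seq n) (tensor φ ψ)) atTop (𝓝 (bracket a (tensor φ ψ))) := by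
  rw [ha.bracket_tensor]
  simp only [fun n ↦ (ha_seq n).bracket_tensor]
  exact tendsto_const_nhds.inner (hA _)

/-- The short-time Fourier transform of the kernel of a bounded operator is bounded by the norm of
the operator, uniformly over all operators. -/
theorem exists_norm_stft_kernel_le (g : 𝓢(Eucl2 d, ℂ)) :
    ∃ C : ℝ, 0 ≤ C ∧ ∀ (A : L2 d →L[ℂ] L2 d) (a : 𝓢'(Eucl2 d, ℂ)), IsKernel A a →
      ∀ z, ‖stft g a z‖ ≤ ‖A‖ * C := by
  obtain ⟨w, hw⟩ := exists_schwartz_ne_zero (Eucl d)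
  let γ := tensor w w
  have hγ : γ 0 ≠ 0 := mul_ne_zero hw hw
  have hpos := integral_norm_sq_pos γ hγ
  let c : ℝ := ∫ x, ‖γ x‖ ^ 2
  have hc : 0 < c := hpos
  let M : ℝ := ‖w.toLp 2 volume‖ * ‖w.toLp 2 volume‖
  -- This is `‖V_γ g‖₁ ‖w‖² / ‖γ‖²`: the inversion formula with each matrix coefficient bounded by
  -- `‖A‖ ‖w‖²`.
  refine ⟨(∫ z, ‖schwartzStft γ g z‖ * M) / c, by positivity, fun A a h z ↦ ?_⟩
  obtain ⟨-, hz⟩ := integral_schwartzStft_bracket a γ g z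
  have h1 : c * ‖stft g a z‖ ≤ ∫ z, ‖A‖ * (‖schwartzStft γ g z‖ * M) := by
    have h2 := congrArg norm hz
    rw [norm_mul, Complex.norm_real, Real.norm_of_nonneg hc.le] at h2
    rw [h2]
    refine norm_integral_le_of_norm_le
      (((integrable_schwartzStft γ g).norm.mul_const M).const_mul _) (ae_of_all _ fun y ↦ ?_)
    rw [norm_mul, RCLike.norm_conj, timeFreqShift_tensor, timeFreqShift_tensor]
    calc _ ≤ ‖schwartzStft γ g y‖ * (‖A‖ * M) := by
          gcongr
          refine (h.norm_bracket_tensor_le _ _).trans_eq ?_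
          simp only [norm_toLp_timeFreqShift, M]
      _ = _ := by ring
  rw [integral_const_mul] at h1
  rw [← mul_div_assoc, le_div_iff₀' hc]
  exact h1

/-- Pointwise convergence of the short-time Fourier transforms of the kernels of a strongly
convergent sequence of operators. -/
theorem tendsto_stft_kernel {A_seq : ℕ → L2 d →L[ℂ] L2 d} {A : L2 d →L[ℂ] L2 d}
    {a_seq : ℕ → 𝓢'(Eucl2 d, ℂ)} {a : 𝓢'(Eucl2 d, ℂ)} (ha_seq : ∀ n, IsKernel (A_seq n) (a_seq n))
    (ha : IsKernel A a) (hA : ∀ f, Tendsto (fun n ↦ A_seq n f) atTop (𝓝 (A f)))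
    {B : ℝ} (hB : ∀ n, ‖A_seq n‖ ≤ B) (g : 𝓢(Eucl2 d, ℂ)) (z : Eucl2 d × Eucl2 d) :
    Tendsto (fun n ↦ stft g (a_seq n) z) atTop (𝓝 (stft g a z)) := by
  obtain ⟨w, hw⟩ := exists_schwartz_ne_zero (Eucl d)
  let γ := tensor w w
  have hγ : γ 0 ≠ 0 := mul_ne_zero hw hw
  have hc : ((∫ x, ‖γ x‖ ^ 2 : ℝ) : ℂ) ≠ 0 :=
    Complex.ofReal_ne_zero.2 (integral_norm_sq_pos γ hγ).ne'
  let M : ℝ := ‖w.toLp 2 volume‖ * ‖w.toLp 2 volume‖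
  have key : Tendsto (fun n ↦ ((∫ x, ‖γ x‖ ^ 2 : ℝ) : ℂ) * stft g (a_seq n) z) atTop
      (𝓝 (((∫ x, ‖γ x‖ ^ 2 : ℝ) : ℂ) * stft g a z)) := by
    simp only [fun u ↦ (integral_schwartzStft_bracket u γ g z).2]
    -- Shifts preserve the `L²` norm and `B` bounds all the operators, so the majorant does not
    -- depend on `n`.
    refine tendsto_integral_of_dominated_convergence (fun y ↦ ‖schwartzStft γ g y‖ * (B * M))
      (fun n ↦ (integral_schwartzStft_bracket (a_seq n) γ g z).1.aestronglyMeasurable)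
      ((integrable_schwartzStft γ g).norm.mul_const _) (fun n ↦ ae_of_all _ fun y ↦ ?_)
      (ae_of_all _ fun y ↦ ?_)
    · rw [norm_mul, RCLike.norm_conj, timeFreqShift_tensor, timeFreqShift_tensor]
      gcongr
      refine ((ha_seq n).norm_bracket_tensor_le _ _).trans ?_
      simp only [norm_toLp_timeFreqShift]
      exact mul_le_mul_of_nonneg_right (hB n) (by positivity)
    · simp only [timeFreqShift_tensor, γ]
      exact (tendsto_bracket_tensor ha_seq ha hA _ _).const_mul _
  have h := key.const_mul (((∫ x, ‖γ x‖ ^ 2 : ℝ) : ℂ)⁻¹)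
  simp only [inv_mul_cancel_left₀ hc] at h
  exact h

/-- Convergent orbits are bounded, so the uniform boundedness principle applies; this supplies the
constant in every domination argument. -/
theorem exists_norm_le_of_tendsto {A_seq : ℕ → L2 d →L[ℂ] L2 d} {A : L2 d →L[ℂ] L2 d}
    (hA : ∀ f, Tendsto (fun n ↦ A_seq n f) atTop (𝓝 (A f))) : ∃ B, ∀ n, ‖A_seq n‖ ≤ B :=
  banach_steinhaus fun f ↦ by
    obtain ⟨C, hC⟩ := (hA f).norm.bddAbove_range
    exact ⟨C, fun n ↦ hC ⟨n, rfl⟩⟩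

theorem mem_modulationSpace_top_of_isKernel {A : L2 d →L[ℂ] L2 d} {a : 𝓢'(Eucl2 d, ℂ)}
    (h : IsKernel A a) (g : 𝓢(Eucl2 d, ℂ)) : a ∈ modulationSpace ∞ g := by
  obtain ⟨C, -, hC⟩ := exists_norm_stft_kernel_le g
  exact memLp_top_of_bound (continuous_stft g a).aestronglyMeasurable (‖A‖ * C)
    (ae_of_all _ fun z ↦ hC A a h z)

theorem tendsto_weakTopology {X Y : Type*} {P : X → Y → ℂ} {x_seq : ℕ → X} {x : X}
    (h : ∀ y, Tendsto (fun n ↦ P (x_seq n) y) atTop (𝓝 (P x y))) :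
    Tendsto x_seq atTop (@nhds _ (weakTopology P) x) := by
  let := weakTopology P
  rw [nhds_induced, tendsto_comap_iff, tendsto_pi_nhds]
  exact h

/-- The kernels of a strongly convergent sequence of operators converge in the weak-* topology of
`M^∞`. -/
theorem tendsto_modulationSpace {A_seq : ℕ → L2 d →L[ℂ] L2 d} {A : L2 d →L[ℂ] L2 d}
    {a_seq : ℕ → 𝓢'(Eucl2 d, ℂ)} {a : 𝓢'(Eucl2 d, ℂ)} (ha_seq : ∀ n, IsKernel (A_seq n) (a_seq n))
    (ha : IsKernel A a) (hA : ∀ f, Tendsto (fun n ↦ A_seq n f) atTop (𝓝 (A f)))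
    (g : 𝓢(Eucl2 d, ℂ)) :
    Tendsto (fun n ↦ (⟨a_seq n, mem_modulationSpace_top_of_isKernel (ha_seq n) g⟩ :
      modulationSpace ∞ g)) atTop
      (@nhds _ (weakStarTopology g) ⟨a, mem_modulationSpace_top_of_isKernel ha g⟩) := by
  obtain ⟨B, hB⟩ := exists_norm_le_of_tendsto hA
  obtain ⟨C, hC0, hC⟩ := exists_norm_stft_kernel_le g
  refine tendsto_weakTopology fun φ ↦ Tendsto.const_mul _ ?_
  have hφ : Integrable (stft g φ.1) := memLp_one_iff_integrable.1 φ.2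
  refine tendsto_integral_of_dominated_convergence (fun z ↦ B * C * ‖stft g φ.1 z‖)
    (fun n ↦ ((continuous_stft g (a_seq n)).mul
      (Complex.continuous_conj.comp (continuous_stft g φ.1))).aestronglyMeasurable)
    (hφ.norm.const_mul _) (fun n ↦ ae_of_all _ fun z ↦ ?_) (ae_of_all _ fun z ↦ ?_)
  · rw [norm_mul, RCLike.norm_conj]
    gcongr
    exact (hC _ _ (ha_seq n) z).trans (mul_le_mul_of_nonneg_right (hB n) hC0)
  · exact (tendsto_stft_kernel ha_seq ha hA hB g z).mul_const _

end Operator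

/-! ### Local Fourier-Lebesgue spaces -/

section FourierLebesgue

variable {V : Type*} [NormedAddCommGroup V] [InnerProductSpace ℝ V]
  [FiniteDimensional ℝ V] [MeasurableSpace V] [BorelSpace V]

/-- The Fourier transform of `conj g * u` is the function `ξ ↦ V_g u (0, ξ)`. -/
theorem fourier_smulLeftCLM_apply (u : 𝓢'(V, ℂ)) (g ψ : 𝓢(V, ℂ)) :
    𝓕 (TemperedDistribution.smulLeftCLM ℂ (conjSchwartz g) u) ψ =
      ∫ ξ, ψ ξ • stft g u (0, ξ) := by
  -- The test function `conj g * 𝓕 ψ` is the superposition of `conj (π(0, ξ) g)` with coefficients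
  -- `ψ ξ`; the decay of `ψ` beats the polynomial growth of their seminorms in `ξ`.
  have h := apply_eq_integral (μ := (volume : Measure V)) u
    (F := fun ξ ↦ ψ ξ • conjSchwartz (timeFreqShift 0 ξ g))
    (Φ := SchwartzMap.smulLeftCLM ℂ (conjSchwartz g) (𝓕 ψ))
    (ψ.continuous.smul (continuous_conjSchwartz.comp
      ((continuous_timeFreqShift g).comp (continuous_const.prodMk continuous_id))))
    (fun k n ↦ by
      obtain ⟨C, hC0, hC⟩ := exists_seminorm_timeFreqShift_le g k n
      refine ⟨fun ξ ↦ C * (‖ψ ξ‖ * (1 + ‖ξ‖) ^ n), ?_, fun ξ ↦ ?_⟩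
      · refine Integrable.const_mul ?_ C
        have h1 : Integrable fun ξ ↦ 2 ^ n * (‖ψ ξ‖ + ‖ξ‖ ^ n * ‖ψ ξ‖) :=
          (ψ.integrable.norm.add (ψ.integrable_pow_mul volume n)).const_mul _
        refine h1.mono' ?_ (ae_of_all _ fun ξ ↦ ?_)
        · have hψ := ψ.continuous
          exact Continuous.aestronglyMeasurable (by fun_prop)
        · rw [Real.norm_of_nonneg (by positivity)]
          have h2 : (1 + ‖ξ‖) ^ n ≤ 2 ^ n * (1 + ‖ξ‖ ^ n) := by
            refine (add_pow_le zero_le_one (norm_nonneg ξ) n).trans ?_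
            rw [one_pow]
            gcongr
            · exact one_le_two
            · omega
          calc _ ≤ ‖ψ ξ‖ * (2 ^ n * (1 + ‖ξ‖ ^ n)) := by gcongr
            _ = _ := by ring
      · rw [map_smul_eq_mul]
        calc _ ≤ ‖ψ ξ‖ * (C * ((1 + ‖(0 : V)‖) ^ k * (1 + ‖ξ‖) ^ n)) := by
              gcongr
              exact (seminorm_conjSchwartz_le k n _).trans (hC 0 ξ)
          _ = _ := by simp; ring)
    (fun y ↦ by
      rw [SchwartzMap.smulLeftCLM_apply_apply (SchwartzMap.hasTemperateGrowth _),
        SchwartzMap.fourier_coe, Real.fourier_eq', smul_eq_mul, ← integral_const_mul]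
      congr 1
      ext ξ
      have h : ((-2 * Real.pi * inner ℝ ξ y : ℝ) : ℂ) * Complex.I =
          2 * Real.pi * Complex.I * ((inner ℝ (-ξ) y : ℝ) : ℂ) := by
        rw [inner_neg_left]
        push_cast
        ring
      rw [h, smul_apply, conjSchwartz_apply, conjSchwartz_apply, timeFreqShift_apply', map_mul,
        conj_character, sub_zero, character, smul_eq_mul, smul_eq_mul]
      ring)
  rw [TemperedDistribution.fourier_apply, TemperedDistribution.smulLeftCLM_apply_apply, h.2]
  simp only [map_smul]
  rfl

theorem toTemperedDistribution_injective {p : ℝ≥0∞} [Fact (1 ≤ p)]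
    {F G : Lp ℂ p (volume : Measure V)}
    (h : Lp.toTemperedDistribution F = Lp.toTemperedDistribution G) : F = G :=
  LinearMap.ker_eq_bot.1 (Lp.ker_toTemperedDistributionCLM_eq_bot (F := ℂ) (p := p)) h

theorem exists_fourier_smulLeftCLM_eq {u : 𝓢'(V, ℂ)} {g : 𝓢(V, ℂ)} {C : ℝ}
    (hC : ∀ z, ‖stft g u z‖ ≤ C) :
    ∃ F : Lp ℂ ∞ (volume : Measure V), (F =ᵐ[volume] fun ξ ↦ stft g u (0, ξ)) ∧
      𝓕 (TemperedDistribution.smulLeftCLM ℂ (conjSchwartz g) u) =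
        Lp.toTemperedDistribution F := by
  have hm : MemLp (fun ξ ↦ stft g u (0, ξ)) ∞ (volume : Measure V) :=
    memLp_top_of_bound ((continuous_stft g u).comp
      (continuous_const.prodMk continuous_id)).aestronglyMeasurable C (ae_of_all _ fun ξ ↦ hC _)
  refine ⟨hm.toLp _, hm.coeFn_toLp, ?_⟩
  ext ψ
  rw [fourier_smulLeftCLM_apply, Lp.toTemperedDistribution_apply]
  refine integral_congr_ae ?_
  filter_upwards [hm.coeFn_toLp] with ξ hξ
  rw [hξ]

/-- A cutoff `φ` acts as the window `conj φ` at position `0`. Since `φ` is arbitrary, boundedness is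
needed for all windows, including zero. -/
theorem mem_localSpace_of_stft_bounded {u : 𝓢'(V, ℂ)}
    (h : ∀ g : 𝓢(V, ℂ), ∃ C, ∀ z, ‖stft g u z‖ ≤ C) :
    u ∈ localSpace (fourierLebesgue V ∞) := by
  intro φ hφ hφc
  obtain ⟨C, hC⟩ := h (conjSchwartz (hφc.toSchwartzMap hφ))
  obtain ⟨F, -, hF⟩ := exists_fourier_smulLeftCLM_eq hC
  rw [conjSchwartz_conjSchwartz] at hF
  exact ⟨F, hF⟩

/-- The density is defined by choice; injectivity of `L^∞ → 𝓢'` pins it down to the explicit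
function. -/
theorem fourierDensity_ae_eq {u : 𝓢'(V, ℂ)} {φ : V → ℂ} (hφ : ContDiff ℝ ∞ φ)
    (hφc : HasCompactSupport φ) {C : ℝ}
    (hC : ∀ z, ‖stft (conjSchwartz (hφc.toSchwartzMap hφ)) u z‖ ≤ C)
    (hu : TemperedDistribution.smulLeftCLM ℂ φ u ∈ fourierLebesgue V ∞) :
    fourierDensity hu =ᵐ[volume]
      fun ξ ↦ stft (conjSchwartz (hφc.toSchwartzMap hφ)) u (0, ξ) := by
  obtain ⟨F, hFae, hF⟩ := exists_fourier_smulLeftCLM_eq hC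
  rw [conjSchwartz_conjSchwartz] at hF
  have h1 : fourierDensity hu = F := toTemperedDistribution_injective (hu.choose_spec.symm.trans hF)
  rw [h1]
  exact hFae

/-- Convergence in `σ((𝓕L^∞)_loc, (𝓕L^1)_comp)` follows from the bounded pointwise convergence of
the short-time Fourier transforms. -/
theorem tendsto_sigmaTopology {u_seq : ℕ → 𝓢'(V, ℂ)} {u : 𝓢'(V, ℂ)}
    (hb : ∀ g : 𝓢(V, ℂ), ∃ C, (∀ n z, ‖stft g (u_seq n) z‖ ≤ C) ∧ ∀ z, ‖stft g u z‖ ≤ C)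
    (ht : ∀ (g : 𝓢(V, ℂ)) z, Tendsto (fun n ↦ stft g (u_seq n) z) atTop (𝓝 (stft g u z)))
    (hu_seq : ∀ n, u_seq n ∈ localSpace (fourierLebesgue V ∞))
    (hu : u ∈ localSpace (fourierLebesgue V ∞)) :
    Tendsto (fun n ↦ (⟨u_seq n, hu_seq n⟩ : localSpace (fourierLebesgue V ∞))) atTop
      (@nhds _ (sigmaTopology V) ⟨u, hu⟩) := by
  refine tendsto_weakTopology fun t ↦ ?_
  let g := conjSchwartz (t.compact.toSchwartzMap t.smooth)
  obtain ⟨C, hC_seq, hC⟩ := hb g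
  -- `𝓕 v` is the integrable factor of the majorant; the other factor is the uniform bound `C` for
  -- the window `conj χ`.
  have hv : Integrable (fourierDensity t.mem.1) volume := L1.integrable_coeFn _
  have e1 : ∀ n, fourierLebesguePairing ⟨u_seq n, hu_seq n⟩ t =
      ∫ ξ : V, stft g (u_seq n) (0, ξ) * conj (fourierDensity t.mem.1 ξ) := fun n ↦ by
    refine integral_congr_ae ?_
    filter_upwards [fourierDensity_ae_eq t.smooth t.compact (hC_seq n)
      (hu_seq n t.χ t.smooth t.compact)] with ξ hξ
    rw [hξ]
  have e2 : fourierLebesguePairing ⟨u, hu⟩ t =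
      ∫ ξ : V, stft g u (0, ξ) * conj (fourierDensity t.mem.1 ξ) := by
    refine integral_congr_ae ?_
    filter_upwards [fourierDensity_ae_eq t.smooth t.compact hC
      (hu t.χ t.smooth t.compact)] with ξ hξ
    rw [hξ]
  simp only [e1, e2]
  refine tendsto_integral_of_dominated_convergence (fun ξ ↦ C * ‖fourierDensity t.mem.1 ξ‖)
    (fun n ↦ ?_) (hv.norm.const_mul C) (fun n ↦ ae_of_all _ fun ξ ↦ ?_) (ae_of_all _ fun ξ ↦ ?_)
  · exact ((continuous_stft g (u_seq n)).comp
      (continuous_const.prodMk continuous_id)).aestronglyMeasurable.mul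
      (Complex.continuous_conj.comp_aestronglyMeasurable hv.aestronglyMeasurable)
  · rw [norm_mul, RCLike.norm_conj]
    gcongr
    exact hC_seq n _
  · exact (ht g _).mul_const _

end FourierLebesgue

end TimeFreq

end

theorem theorem4 (d : ℕ)
    (A_seq : ℕ → TimeFreq.L2 d →L[ℂ] TimeFreq.L2 d) (A : TimeFreq.L2 d →L[ℂ] TimeFreq.L2 d)
    (a_seq : ℕ → 𝓢'(TimeFreq.Eucl2 d, ℂ)) (a : 𝓢'(TimeFreq.Eucl2 d, ℂ))
    (ha_seq : ∀ n, TimeFreq.IsKernel (A_seq n) (a_seq n)) (ha : TimeFreq.IsKernel A a)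
    (hA : ∀ f : TimeFreq.L2 d, Tendsto (fun n ↦ A_seq n f) atTop (𝓝 (A f))) :
    (∀ g : 𝓢(TimeFreq.Eucl2 d, ℂ), g ≠ 0 →
      ∃ (hM_seq : ∀ n, a_seq n ∈ TimeFreq.modulationSpace ∞ g)
        (hM : a ∈ TimeFreq.modulationSpace ∞ g),
        Tendsto (fun n ↦ (⟨a_seq n, hM_seq n⟩ : TimeFreq.modulationSpace ∞ g)) atTop
          (@nhds _ (TimeFreq.weakStarTopology g) ⟨a, hM⟩)) ∧
    ∃ (hF_seq : ∀ n, a_seq n ∈ TimeFreq.localSpace (TimeFreq.fourierLebesgue (TimeFreq.Eucl2 d) ∞))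
      (hF : a ∈ TimeFreq.localSpace (TimeFreq.fourierLebesgue (TimeFreq.Eucl2 d) ∞)),
      Tendsto (fun n ↦ (⟨a_seq n, hF_seq n⟩ :
          TimeFreq.localSpace (TimeFreq.fourierLebesgue (TimeFreq.Eucl2 d) ∞))) atTop
        (@nhds _ (TimeFreq.sigmaTopology (TimeFreq.Eucl2 d)) ⟨a, hF⟩) := by
  obtain ⟨B, hB⟩ := TimeFreq.exists_norm_le_of_tendsto hA
  have hb : ∀ g : 𝓢(TimeFreq.Eucl2 d, ℂ), ∃ C, (∀ n z, ‖TimeFreq.stft g (a_seq n) z‖ ≤ C) ∧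
      ∀ z, ‖TimeFreq.stft g a z‖ ≤ C := fun g ↦ by
    obtain ⟨C, hC0, hC⟩ := TimeFreq.exists_norm_stft_kernel_le g
    -- The maximum covers the sequence and its limit with one constant.
    refine ⟨max B ‖A‖ * C, fun n z ↦ (hC _ _ (ha_seq n) z).trans ?_,
      fun z ↦ (hC _ _ ha z).trans ?_⟩
    · exact mul_le_mul_of_nonneg_right ((hB n).trans (le_max_left _ _)) hC0
    · exact mul_le_mul_of_nonneg_right (le_max_right _ _) hC0
  refine ⟨fun g _ ↦ ⟨fun n ↦ TimeFreq.mem_modulationSpace_top_of_isKernel (ha_seq n) g,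
    TimeFreq.mem_modulationSpace_top_of_isKernel ha g,
    TimeFreq.tendsto_modulationSpace ha_seq ha hA g⟩,
    fun n ↦ TimeFreq.mem_localSpace_of_stft_bounded fun g ↦ ?_,
    TimeFreq.mem_localSpace_of_stft_bounded fun g ↦ ?_,
    TimeFreq.tendsto_sigmaTopology hb
      (fun g z ↦ TimeFreq.tendsto_stft_kernel ha_seq ha hA hB g z) _ _⟩
  · obtain ⟨C, hC, -⟩ := hb g
    exact ⟨C, hC n⟩
  · obtain ⟨C, -, hC⟩ := hb g
    exact ⟨C, hC⟩
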